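/- **Setting.** Let $\mathcal M=(\mathcal S,\mathcal A_1,\mathcal A_2,\mathcal Z_1,\mathcal Z_2,p,r,b,\gamma,\ell)$ be a zero-sum partially observable stochastic game: $\mathcal S,\mathcal A_i,\mathcal Z_i$ are finite sets ($\mathcal A_i\neq\emptyset$), $p(s',z_1,z_2\mid s,a_1,a_2)$ is a probability kernel, $r:\mathcal S\times\mathcal A_1\times\mathcal A_2\to\mathbb R$, $b\in\Delta(\mathcal S)$, $\gamma\in[0,1)$, $\ell\in\mathbb N$. Player 1 maximises and player 2 minimises. A private history $h_{i,t}$ is a sequence of $t$ pairs (own action, own observation); a decision rule $d_{i,t}\in\mathcal D_{i,t}$ maps private histories of length $t$ to $\Delta(\mathcal A_i)$; a policy is $\pi_i=(d_{i,0},\dots,d_{i,\ell-1})$; $v_{\pi_1,\pi_2}(b)$ is the expected return $\mathbb E\sum_{t<\ell}\gamma^t r(s_t,a_{1,t},a_{2,t})$. *Central states.* For decision-rule histories $\theta_{1,t}=(d_{1,k},d_{2,k})_{k<t}$ and $\theta_{2,t}=(\theta_{1,t},d_{1,t})$ let $x_{1,t}(s,h_1,h_2)=\Pr(s,h_1,h_2\mid\theta_{1,t})$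 and $x_{2,t}(s,h_1,h_2,a_1)=\Pr(s,h_1,h_2,a_1\mid\theta_{2,t})$; these vectors form $\mathcal X_{\mathrm{seq}}$. At sub-stage $(1,t)$, $\tau_{\mathrm{seq}}(x_1,d_1)(s,h_1,h_2,a_1)=x_1(s,h_1,h_2)\,d_1(a_1\mid h_1)$, $\rho_{\mathrm{seq}}=0$, $\gamma_1=1$. At sub-stage $(2,t)$, $\tau_{\mathrm{seq}}(x_2,d_2)(s',h_1a_1z_1,h_2a_2z_2)=\sum_s x_2(s,h_1,h_2,a_1)\,d_2(a_2\mid h_2)\,p(s',z_1,z_2\mid s,a_1,a_2)$, $\rho_{\mathrm{seq}}(x_2,d_2)=\sum x_2(s,h_1,h_2,a_1)\,d_2(a_2\mid h_2)\,r(s,a_1,a_2)$, $\gamma_2=\gamma$. *Local states.* The occupancy family $\mathbf o_{1,t}$ of player 1 is the set of all $x_{1,t}$ that are consistent with player 1's decision rules $d_{1,0},\dots,d_{1,t-1}$, over all decision rules of player 2; the family $\mathbf o_{2,t}$ of player 2 is the set of all $x_{2,t}$ consistent with $d_{2,0},\dots,d_{2,t-1}$, over all decision rules of player 1 up to stage $t$;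 player 2's terminal family is the set of all $x_{1,\ell}$ consistent with its policy. The compatibility operator is $\varphi_{\mathrm{seq}}(\mathbf o,\mathbf o',d)=\{\tau_{\mathrm{seq}}(x,d):x\in\mathbf o\}\cap\mathbf o'$. For a terminal state $x_{1,\ell}$ let $g(x_{1,\ell})$ be the return of the decision-rule histories that lead to it; the terminal reward of player 1's (player 2's) local process on a terminal family $\mathbf o$ is $\min_{x\in\mathbf o}g(x)$ ($\max_{x\in\mathbf o}g(x)$), and its other rewards are $0$. *The game $\mathcal M'_{\mathrm{seq}}$.* A strategy $\sigma_i$ of player $i$ assigns to each of its local states $\mathbf o_{i,t}$, $t<\ell$, a decision rule in $\mathcal D_{i,t}$. A strategy generates a sequence of own decision rules (and own local states), i.e. it executes a policy $E_i(\sigma_i)$ of $\mathcal M$. The central state starts at $x_{1,0}=b$ and moves by $\tau_{\mathrm{seq}}$; the return $J(\sigma_1,\sigma_2)$ is the sum of the rewards $\rho_{\mathrm{seq}}$, discounted with $\gamma_1,\gamma_2$. The optimal value $v^*_{\mathrm{seq}}(x)$ of $x\in\mathcal X_{\mathrm{seq}}$ is the max–min, over the players' decision rules from the sub-stage of $x$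 on, of the return from $x$ on. The simultaneous game has states $x_{1,t}$, one-stage transition $\tau(x,d_1,d_2)(s',h_1a_1z_1,h_2a_2z_2)=\sum_s x(s,h_1,h_2)d_1(a_1\mid h_1)d_2(a_2\mid h_2)p(s',z_1,z_2\mid s,a_1,a_2)$, reward $\rho(x,d_1,d_2)=\sum x(s,h_1,h_2)d_1(a_1\mid h_1)d_2(a_2\mid h_2)r(s,a_1,a_2)$, and optimal (max–min) value $v^*_{\mathrm{sim}}$. **Theorem.** (A) $\mathcal M'_{\mathrm{seq}}$ is a lossless reduction of $\mathcal M$: 1. *Values.* $J(\sigma_1,\sigma_2)=v_{E_1(\sigma_1),E_2(\sigma_2)}(b)$ for all strategies, and every joint policy of $\mathcal M$ is executed by some strategy profile, which has the same return. Max–min and min–max, all attained, over policies in $\mathcal M$ and over strategies in $\mathcal M'_{\mathrm{seq}}$ all equal $v^*_{\mathrm{seq}}(x_{1,0})$. The function $g$ is well defined: $g(x_{1,\ell})=v_{\pi_1,\pi_2}(b)$ if $(\pi_1,\pi_2)$ leads to $x_{1,\ell}$. The terminal reward of player 1's local process under $\sigma_1$ is $\min_{\pi_2}v_{E_1(\sigma_1),\pi_2}(b)$,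 that of player 2's under $\sigma_2$ is $\max_{\pi_1}v_{\pi_1,E_2(\sigma_2)}(b)$, and the optimal values of both local processes are $v^*_{\mathrm{seq}}(x_{1,0})$. 2. *Equilibria.* The map $(\sigma_1,\sigma_2)\mapsto(E_1(\sigma_1),E_2(\sigma_2))$ onto the joint policies of $\mathcal M$ is surjective; $(\sigma_1,\sigma_2)$ is a Nash equilibrium of $\mathcal M'_{\mathrm{seq}}$ if and only if its image is a Nash equilibrium of $\mathcal M$; the equilibria of $\mathcal M'_{\mathrm{seq}}$ are mapped onto those of $\mathcal M$. 3. *Information structure.* The central states generated by $\tau_{\mathrm{seq}}$ are the laws $x_{1,t}$, $x_{2,t}$ above, and $\rho_{\mathrm{seq}}$ at $(2,t)$ is the expected stage reward. Each player's family evolves as a function of its current family and its own decision rule only. A player's family at its activation (and at the end) is exactly the set of central states that arise, as the opponent's strategy varies. The operator $\varphi_{\mathrm{seq}}$, applied to the families $\mathbf o_{1,t},\mathbf o_{2,t}$ and $d_{1,t}$, or to $\mathbf o_{2,t},\mathbf o_{1,t+1}$ and $d_{2,t}$, yields the singleton of the successor central state. Two decision-rule histories of a player with the same family give the same central state against every decision-rule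 history of the opponent, and, when continued by the same decision rules, the same return against every policy of the opponent. (B) Composing the two sub-stages of each stage recovers the simultaneous optimality equations: for stage-boundary states $x$, $\tau_{\mathrm{seq}}(\tau_{\mathrm{seq}}(x,d_1),d_2)=\tau(x,d_1,d_2)$ and $\rho_{\mathrm{seq}}(x,d_1)+\gamma_1\rho_{\mathrm{seq}}(\tau_{\mathrm{seq}}(x,d_1),d_2)=\rho(x,d_1,d_2)$. The maxima and minima defining $v^*_{\mathrm{seq}}$ and $v^*_{\mathrm{sim}}$ are attained, $v^*_{\mathrm{seq}}$ vanishes at $t=\ell$, and for $t<\ell$ $$v^*_{\mathrm{seq}}(x_{1,t})=\max_{d_1}\bigl[\rho_{\mathrm{seq}}(x_{1,t},d_1)+\gamma_1v^*_{\mathrm{seq}}(\tau_{\mathrm{seq}}(x_{1,t},d_1))\bigr],\qquad v^*_{\mathrm{seq}}(x_{2,t})=\min_{d_2}\bigl[\rho_{\mathrm{seq}}(x_{2,t},d_2)+\gamma_2v^*_{\mathrm{seq}}(\tau_{\mathrm{seq}}(x_{2,t},d_2))\bigr],$$ $$v^*_{\mathrm{seq}}(x_{1,t})=\max_{d_1\in\mathcal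 D_{1,t}}\min_{d_2\in\mathcal D_{2,t}}\bigl[\rho(x_{1,t},d_1,d_2)+\gamma\,v^*_{\mathrm{seq}}(\tau(x_{1,t},d_1,d_2))\bigr],$$ and $v^*_{\mathrm{seq}}=v^*_{\mathrm{sim}}$ at all stage-boundary states. Moreover, if $(u_1,u_2)$ is any solution of the pair of sequential equations (with $u_1=0$ at $t=\ell$), then $u_1$ solves the simultaneous equations, and every solution $u$ of the simultaneous equations is the first component of a solution $(u,u_2)$ of the sequential ones. -/

import Mathlib

/-! ### Zero-sum games in normal form -/

/-- `v = max_a min_b f a b`, where the maximum and all the minima are attained. -/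
def IsMaxMin {α β : Type*} (f : α → β → ℝ) (v : ℝ) : Prop :=
  ∃ m : α → ℝ, (∀ a, IsLeast (Set.range (f a)) (m a)) ∧ IsGreatest (Set.range m) v

/-- `v = min_b max_a f a b`, where the minimum and all the maxima are attained. -/
def IsMinMax {α β : Type*} (f : α → β → ℝ) (v : ℝ) : Prop :=
  ∃ m : β → ℝ, (∀ b, IsGreatest (Set.range fun a => f a b) (m b)) ∧ IsLeast (Set.range m) v

/-- The Nash equilibria of the zero-sum game with payoff `f` to the first player. -/
def equilibria {α β : Type*} (f : α → β → ℝ) : Set (α × β) :=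
  {ab | (∀ a, f a ab.2 ≤ f ab.1 ab.2) ∧ ∀ b, f ab.1 ab.2 ≤ f ab.1 b}

/-! ### Histories, decision rules, policies -/

/-- Private histories of length `t`: one action and one observation per past stage. -/
abbrev Hist (A Z : Type*) (t : ℕ) := Fin t → A × Z

/-- The initial segment of length `k` of a private history. -/
def Hist.take {A Z : Type*} {t : ℕ} (h : Hist A Z t) (k : ℕ) (hk : k ≤ t) : Hist A Z k :=
  fun j => h ⟨j, j.2.trans_le hk⟩

/-- Decision rules at stage `t`: a distribution over actions for every private history. -/
abbrev DecRule (A Z : Type*) [Fintype A] (t : ℕ) := Hist A Z t → stdSimplex ℝ A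

/-- Decision-rule histories `(d_0, …, d_{t-1})` of one player. -/
abbrev RuleHist (A Z : Type*) [Fintype A] (t : ℕ) := (k : Fin t) → DecRule A Z k

namespace RuleHist

variable {A Z : Type*} [Fintype A] {t : ℕ}

/-- Drop the last decision rule. -/
def init (θ : RuleHist A Z (t + 1)) : RuleHist A Z t := fun k => θ k.castSucc

/-- The last decision rule. -/
def last (θ : RuleHist A Z (t + 1)) : DecRule A Z t := θ (Fin.last t)

/-- Append a decision rule. -/
def snoc (θ : RuleHist A Z t) (d : DecRule A Z t) : RuleHist A Z (t + 1) :=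
  Fin.snoc (α := fun k : Fin (t + 1) => DecRule A Z k) θ d

/-- The first `k` decision rules. -/
def take (θ : RuleHist A Z t) (k : ℕ) (hk : k ≤ t) : RuleHist A Z k :=
  fun j => θ ⟨j, j.2.trans_le hk⟩

end RuleHist

/-- A finite-horizon simultaneous-move zero-sum partially observable stochastic game. -/
structure ZSPOSG (S A₁ A₂ Z₁ Z₂ : Type*) [Fintype S] [Fintype Z₁] [Fintype Z₂] where
  /-- `p s a₁ a₂ (s', z₁, z₂)` is the probability of the next state and the observations. -/
  p : S → A₁ → A₂ → stdSimplex ℝ (S × Z₁ × Z₂)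
  /-- Reward of player 1, cost of player 2. -/
  r : S → A₁ → A₂ → ℝ
  /-- Initial distribution. -/
  b : stdSimplex ℝ S
  /-- Discount factor. -/
  γ : ℝ
  γ_nonneg : 0 ≤ γ
  γ_lt_one : γ < 1
  /-- Horizon. -/
  ℓ : ℕ

/-- Vectors indexed by `(s, h₁, h₂)`: the stage-boundary occupancies `x_{1,t}` live here. -/
abbrev Occ₁ (S A₁ A₂ Z₁ Z₂ : Type*) (t : ℕ) := S → Hist A₁ Z₁ t → Hist A₂ Z₂ t → ℝ

/-- Vectors indexed by `(s, h₁, h₂, a₁)`: the intermediate occupancies `x_{2,t}` live here. -/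
abbrev Occ₂ (S A₁ A₂ Z₁ Z₂ : Type*) (t : ℕ) := S → Hist A₁ Z₁ t → Hist A₂ Z₂ t → A₁ → ℝ

noncomputable section

namespace ZSPOSG

variable {S A₁ A₂ Z₁ Z₂ : Type*} [Fintype S] [Fintype A₁] [Fintype A₂] [Fintype Z₁] [Fintype Z₂]
variable (G : ZSPOSG S A₁ A₂ Z₁ Z₂)

/-! ### The original game -/

/-- Policies of player 1: one decision rule for each stage `0, …, ℓ - 1`. -/
abbrev Policy₁ := RuleHist A₁ Z₁ G.ℓ

/-- Policies of player 2. -/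
abbrev Policy₂ := RuleHist A₂ Z₂ G.ℓ

/-- Probability of the states `w 0, …, w t` together with the private histories `h₁, h₂`, when the
players use the decision rules `θ₁, θ₂` in stages `0, …, t - 1`. -/
def trajProb {t : ℕ} (θ₁ : RuleHist A₁ Z₁ t) (θ₂ : RuleHist A₂ Z₂ t)
    (w : Fin (t + 1) → S) (h₁ : Hist A₁ Z₁ t) (h₂ : Hist A₂ Z₂ t) : ℝ :=
  G.b (w 0) * ∏ k : Fin t,
    (θ₁ k (h₁.take k k.2.le) (h₁ k).1 * θ₂ k (h₂.take k k.2.le) (h₂ k).1 *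
      G.p (w k.castSucc) (h₁ k).1 (h₂ k).1 (w k.succ, (h₁ k).2, (h₂ k).2))

/-- Expected discounted return of a joint policy in the original game. -/
def value (π₁ : G.Policy₁) (π₂ : G.Policy₂) : ℝ :=
  ∑ w : Fin (G.ℓ + 1) → S, ∑ h₁ : Hist A₁ Z₁ G.ℓ, ∑ h₂ : Hist A₂ Z₂ G.ℓ,
    G.trajProb π₁ π₂ w h₁ h₂ *
      ∑ k : Fin G.ℓ, G.γ ^ (k : ℕ) * G.r (w k.castSucc) (h₁ k).1 (h₂ k).1

/-! ### Sequential occupancy states -/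

/-- `x_{1,t}(s, h₁, h₂) = Pr(s_t = s, h₁, h₂ | θ₁, θ₂)`, the law of the current state and the private
histories at stage `t` (the states `w` before stage `t` are summed out). -/
def occ₁ {t : ℕ} (θ₁ : RuleHist A₁ Z₁ t) (θ₂ : RuleHist A₂ Z₂ t) : Occ₁ S A₁ A₂ Z₁ Z₂ t :=
  fun s h₁ h₂ => ∑ w : Fin t → S, G.trajProb θ₁ θ₂ (Fin.snoc (α := fun _ => S) w s) h₁ h₂

/-- `x_{2,t}(s, h₁, h₂, a₁) = Pr(s_t = s, h₁, h₂, a_{1,t} = a₁ | θ₁, θ₂)`; here player 1 has already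
committed to its rule of stage `t`, player 2 has not. -/
def occ₂ {t : ℕ} (θ₁ : RuleHist A₁ Z₁ (t + 1)) (θ₂ : RuleHist A₂ Z₂ t) :
    Occ₂ S A₁ A₂ Z₁ Z₂ t :=
  fun s h₁ h₂ a₁ => ∑ w : Fin t → S,
    G.trajProb θ₁.init θ₂ (Fin.snoc (α := fun _ => S) w s) h₁ h₂ * θ₁.last h₁ a₁

/-- The stage-boundary part of the state space, at sub-stage `(1,t)`. -/
def X₁ (t : ℕ) : Set (Occ₁ S A₁ A₂ Z₁ Z₂ t) :=
  {x | ∃ (θ₁ : RuleHist A₁ Z₁ t) (θ₂ : RuleHist A₂ Z₂ t), x = G.occ₁ θ₁ θ₂}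

/-- The intermediate part of the state space, at sub-stage `(2,t)`. -/
def X₂ (t : ℕ) : Set (Occ₂ S A₁ A₂ Z₁ Z₂ t) :=
  {x | ∃ (θ₁ : RuleHist A₁ Z₁ (t + 1)) (θ₂ : RuleHist A₂ Z₂ t), x = G.occ₂ θ₁ θ₂}

/-- The initial occupancy `x_{1,0}`: the initial distribution with empty histories. -/
def x₀ : Occ₁ S A₁ A₂ Z₁ Z₂ 0 := fun s _ _ => G.b s

/-! ### Sequential primitives -/

/-- The transition at sub-stage `(1,t)`. -/
def τ₁ {t : ℕ} (x : Occ₁ S A₁ A₂ Z₁ Z₂ t) (d₁ : DecRule A₁ Z₁ t) : Occ₂ S A₁ A₂ Z₁ Z₂ t :=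
  fun s h₁ h₂ a₁ => x s h₁ h₂ * d₁ h₁ a₁

/-- The transition at sub-stage `(2,t)`; the last entry of a new history is the realised pair of
action and observation. -/
def τ₂ {t : ℕ} (x : Occ₂ S A₁ A₂ Z₁ Z₂ t) (d₂ : DecRule A₂ Z₂ t) :
    Occ₁ S A₁ A₂ Z₁ Z₂ (t + 1) :=
  fun s' h₁ h₂ =>
    ∑ s : S, x s (h₁.take t t.le_succ) (h₂.take t t.le_succ) (h₁ (Fin.last t)).1 *
      d₂ (h₂.take t t.le_succ) (h₂ (Fin.last t)).1 *
      G.p s (h₁ (Fin.last t)).1 (h₂ (Fin.last t)).1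
        (s', (h₁ (Fin.last t)).2, (h₂ (Fin.last t)).2)

/-- The reward at sub-stage `(1,t)`. -/
def ρ₁ {t : ℕ} (_x : Occ₁ S A₁ A₂ Z₁ Z₂ t) (_d₁ : DecRule A₁ Z₁ t) : ℝ := 0

/-- The reward at sub-stage `(2,t)`: the expected reward of the original stage. -/
def ρ₂ {t : ℕ} (x : Occ₂ S A₁ A₂ Z₁ Z₂ t) (d₂ : DecRule A₂ Z₂ t) : ℝ :=
  ∑ s : S, ∑ h₁ : Hist A₁ Z₁ t, ∑ h₂ : Hist A₂ Z₂ t, ∑ a₁ : A₁, ∑ a₂ : A₂,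
    x s h₁ h₂ a₁ * d₂ h₂ a₂ * G.r s a₁ a₂

/-- The discount factor at the first sub-stage of each stage. -/
def γ₁ : ℝ := 1

/-- The discount factor at the second sub-stage of each stage. -/
def γ₂ : ℝ := G.γ

/-- The central state at `(1,t)` generated by the sequential transitions. -/
def state₁ : {t : ℕ} → RuleHist A₁ Z₁ t → RuleHist A₂ Z₂ t → Occ₁ S A₁ A₂ Z₁ Z₂ t
  | 0, _, _ => G.x₀
  | _ + 1, θ₁, θ₂ => G.τ₂ (τ₁ (state₁ θ₁.init θ₂.init) θ₁.last) θ₂.last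

/-- The central state at `(2,t)` generated by the sequential transitions. -/
def state₂ {t : ℕ} (θ₁ : RuleHist A₁ Z₁ (t + 1)) (θ₂ : RuleHist A₂ Z₂ t) :
    Occ₂ S A₁ A₂ Z₁ Z₂ t :=
  τ₁ (G.state₁ θ₁.init θ₂) θ₁.last

/-- Return from sub-stage `(1,t)` on, starting at the central state `x`. Only the components
`t, …, ℓ - 1` of the two policies matter. -/
def ret₁ (t : ℕ) (x : Occ₁ S A₁ A₂ Z₁ Z₂ t) (π₁ : G.Policy₁) (π₂ : G.Policy₂) : ℝ :=
  if h : t < G.ℓ then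
    ρ₁ x (π₁ ⟨t, h⟩) + γ₁ *
      (G.ρ₂ (τ₁ x (π₁ ⟨t, h⟩)) (π₂ ⟨t, h⟩) + G.γ₂ *
        ret₁ (t + 1) (G.τ₂ (τ₁ x (π₁ ⟨t, h⟩)) (π₂ ⟨t, h⟩)) π₁ π₂)
  else 0
termination_by G.ℓ - t

/-- Return from sub-stage `(2,t)` on, starting at the central state `x`. -/
def ret₂ (t : ℕ) (x : Occ₂ S A₁ A₂ Z₁ Z₂ t) (π₁ : G.Policy₁) (π₂ : G.Policy₂) : ℝ :=
  if h : t < G.ℓ then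
    G.ρ₂ x (π₂ ⟨t, h⟩) + G.γ₂ * G.ret₁ (t + 1) (G.τ₂ x (π₂ ⟨t, h⟩)) π₁ π₂
  else 0

/-- The optimal sequential value function at the states of sub-stage `(1,t)`. -/
def vSeq₁ (t : ℕ) (x : Occ₁ S A₁ A₂ Z₁ Z₂ t) : ℝ :=
  ⨆ π₁ : G.Policy₁, ⨅ π₂ : G.Policy₂, G.ret₁ t x π₁ π₂

/-- The optimal sequential value function at the states of sub-stage `(2,t)`. -/
def vSeq₂ (t : ℕ) (x : Occ₂ S A₁ A₂ Z₁ Z₂ t) : ℝ :=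
  ⨆ π₁ : G.Policy₁, ⨅ π₂ : G.Policy₂, G.ret₂ t x π₁ π₂

/-! ### Occupancy families and the local (focal) processes -/

/-- The occupancy family `o_{1,t}`: the states at `(1,t)` consistent with player 1's decision-rule
history, over all evolutions of player 2. -/
def fam₁ {t : ℕ} (θ₁ : RuleHist A₁ Z₁ t) : Set (Occ₁ S A₁ A₂ Z₁ Z₂ t) :=
  {x | ∃ θ₂ : RuleHist A₂ Z₂ t, x = G.occ₁ θ₁ θ₂}

/-- The occupancy family `o_{2,t}`: the states at `(2,t)` consistent with player 2's decision-rule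
history, over all evolutions of player 1 (including player 1's rule of stage `t`). -/
def fam₂ {t : ℕ} (θ₂ : RuleHist A₂ Z₂ t) : Set (Occ₂ S A₁ A₂ Z₁ Z₂ t) :=
  {x | ∃ θ₁ : RuleHist A₁ Z₁ (t + 1), x = G.occ₂ θ₁ θ₂}

/-- The terminal family of player 2, after sub-stage `(2, ℓ - 1)`; it consists of terminal states. -/
def famEnd₂ (π₂ : G.Policy₂) : Set (Occ₁ S A₁ A₂ Z₁ Z₂ G.ℓ) :=
  {x | ∃ π₁ : G.Policy₁, x = G.occ₁ π₁ π₂}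

/-- Local states of player 1 at its activation in stage `t`. -/
abbrev O₁ (t : ℕ) := {o : Set (Occ₁ S A₁ A₂ Z₁ Z₂ t) // ∃ θ₁ : RuleHist A₁ Z₁ t, o = G.fam₁ θ₁}

/-- Local states of player 2 at its activation in stage `t`. -/
abbrev O₂ (t : ℕ) := {o : Set (Occ₂ S A₁ A₂ Z₁ Z₂ t) // ∃ θ₂ : RuleHist A₂ Z₂ t, o = G.fam₂ θ₂}

/-- Local transition of player 1, from its activation in stage `t` to the next one. -/
def τLoc₁ {t : ℕ} (o : Set (Occ₁ S A₁ A₂ Z₁ Z₂ t)) (d₁ : DecRule A₁ Z₁ t) :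
    Set (Occ₁ S A₁ A₂ Z₁ Z₂ (t + 1)) :=
  {y | ∃ x ∈ o, ∃ d₂ : DecRule A₂ Z₂ t, y = G.τ₂ (τ₁ x d₁) d₂}

/-- Local transition of player 2, from its activation in stage `t` to the next one. -/
def τLoc₂ {t : ℕ} (o : Set (Occ₂ S A₁ A₂ Z₁ Z₂ t)) (d₂ : DecRule A₂ Z₂ t) :
    Set (Occ₂ S A₁ A₂ Z₁ Z₂ (t + 1)) :=
  {y | ∃ x ∈ o, ∃ d₁ : DecRule A₁ Z₁ (t + 1), y = τ₁ (G.τ₂ x d₂) d₁}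

/-- Compatibility operator at `(1,t)`: propagate `o_{1,t}` and match with `o_{2,t}`. -/
def φ₁ {t : ℕ} (o : Set (Occ₁ S A₁ A₂ Z₁ Z₂ t)) (o' : Set (Occ₂ S A₁ A₂ Z₁ Z₂ t))
    (d₁ : DecRule A₁ Z₁ t) : Set (Occ₂ S A₁ A₂ Z₁ Z₂ t) :=
  (fun x => τ₁ x d₁) '' o ∩ o'

/-- Compatibility operator at `(2,t)`: propagate `o_{2,t}` and match with `o_{1,t+1}`. -/
def φ₂ {t : ℕ} (o : Set (Occ₂ S A₁ A₂ Z₁ Z₂ t)) (o' : Set (Occ₁ S A₁ A₂ Z₁ Z₂ (t + 1)))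
    (d₂ : DecRule A₂ Z₂ t) : Set (Occ₁ S A₁ A₂ Z₁ Z₂ (t + 1)) :=
  (fun x => G.τ₂ x d₂) '' o ∩ o'

/-- The total return `g(x)` recorded by a terminal state `x`: the return of the decision-rule
histories that lead to `x` (they all have the same return). -/
def termReturn (x : Occ₁ S A₁ A₂ Z₁ Z₂ G.ℓ) : ℝ :=
  sInf {v | ∃ (π₁ : G.Policy₁) (π₂ : G.Policy₂), G.state₁ π₁ π₂ = x ∧ v = G.ret₁ 0 G.x₀ π₁ π₂}

/-- Terminal reward of player 1's local process (its rewards before are zero): `min_{x ∈ o} g(x)`. -/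
def ρLoc₁ (o : Set (Occ₁ S A₁ A₂ Z₁ Z₂ G.ℓ)) : ℝ := sInf (G.termReturn '' o)

/-- Terminal reward of player 2's local process (its rewards before are zero): `max_{x ∈ o} g(x)`. -/
def ρLoc₂ (o : Set (Occ₁ S A₁ A₂ Z₁ Z₂ G.ℓ)) : ℝ := sSup (G.termReturn '' o)

/-! ### Playing the sequential transition-independent game -/

/-- Strategies of player 1: a decision rule for every local state of player 1. -/
abbrev Strategy₁ := (t : Fin G.ℓ) → G.O₁ t → DecRule A₁ Z₁ t

/-- Strategies of player 2: a decision rule for every local state of player 2. -/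
abbrev Strategy₂ := (t : Fin G.ℓ) → G.O₂ t → DecRule A₂ Z₂ t

/-- The decision rules that a strategy of player 1 selects before stage `t`. -/
def playTo₁ (σ₁ : G.Strategy₁) : (t : ℕ) → t ≤ G.ℓ → RuleHist A₁ Z₁ t
  | 0, _ => fun k => k.elim0
  | t + 1, h =>
    let θ₁ := playTo₁ σ₁ t (Nat.le_of_succ_le h)
    θ₁.snoc (σ₁ ⟨t, h⟩ ⟨G.fam₁ θ₁, θ₁, rfl⟩)

/-- The decision rules that a strategy of player 2 selects before stage `t`. -/
def playTo₂ (σ₂ : G.Strategy₂) : (t : ℕ) → t ≤ G.ℓ → RuleHist A₂ Z₂ t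
  | 0, _ => fun k => k.elim0
  | t + 1, h =>
    let θ₂ := playTo₂ σ₂ t (Nat.le_of_succ_le h)
    θ₂.snoc (σ₂ ⟨t, h⟩ ⟨G.fam₂ θ₂, θ₂, rfl⟩)

/-- The policy of the original game that a strategy of player 1 executes. -/
def exec₁ (σ₁ : G.Strategy₁) : G.Policy₁ := G.playTo₁ σ₁ G.ℓ le_rfl

/-- The policy of the original game that a strategy of player 2 executes. -/
def exec₂ (σ₂ : G.Strategy₂) : G.Policy₂ := G.playTo₂ σ₂ G.ℓ le_rfl

/-- Return of a strategy profile in the sequential game: the central state starts at `x_{1,0}`, moves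
by the sequential transitions and pays the sequential rewards. -/
def seqReturn (σ₁ : G.Strategy₁) (σ₂ : G.Strategy₂) : ℝ :=
  G.ret₁ 0 G.x₀ (G.exec₁ σ₁) (G.exec₂ σ₂)

/-! ### The simultaneous game on stage-boundary occupancies -/

/-- One-stage transition of the simultaneous game. -/
def τSim {t : ℕ} (x : Occ₁ S A₁ A₂ Z₁ Z₂ t) (d₁ : DecRule A₁ Z₁ t) (d₂ : DecRule A₂ Z₂ t) :
    Occ₁ S A₁ A₂ Z₁ Z₂ (t + 1) :=
  fun s' h₁ h₂ =>
    ∑ s : S, x s (h₁.take t t.le_succ) (h₂.take t t.le_succ) *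
      d₁ (h₁.take t t.le_succ) (h₁ (Fin.last t)).1 *
      d₂ (h₂.take t t.le_succ) (h₂ (Fin.last t)).1 *
      G.p s (h₁ (Fin.last t)).1 (h₂ (Fin.last t)).1
        (s', (h₁ (Fin.last t)).2, (h₂ (Fin.last t)).2)

/-- One-stage reward of the simultaneous game. -/
def ρSim {t : ℕ} (x : Occ₁ S A₁ A₂ Z₁ Z₂ t) (d₁ : DecRule A₁ Z₁ t) (d₂ : DecRule A₂ Z₂ t) : ℝ :=
  ∑ s : S, ∑ h₁ : Hist A₁ Z₁ t, ∑ h₂ : Hist A₂ Z₂ t, ∑ a₁ : A₁, ∑ a₂ : A₂,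
    x s h₁ h₂ * d₁ h₁ a₁ * d₂ h₂ a₂ * G.r s a₁ a₂

/-- Return of the simultaneous game from stage `t` on, starting at `x`. -/
def retSim (t : ℕ) (x : Occ₁ S A₁ A₂ Z₁ Z₂ t) (π₁ : G.Policy₁) (π₂ : G.Policy₂) : ℝ :=
  if h : t < G.ℓ then
    G.ρSim x (π₁ ⟨t, h⟩) (π₂ ⟨t, h⟩) +
      G.γ * retSim (t + 1) (G.τSim x (π₁ ⟨t, h⟩) (π₂ ⟨t, h⟩)) π₁ π₂
  else 0
termination_by G.ℓ - t

/-- The optimal value function of the simultaneous game. -/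
def vSim (t : ℕ) (x : Occ₁ S A₁ A₂ Z₁ Z₂ t) : ℝ :=
  ⨆ π₁ : G.Policy₁, ⨅ π₂ : G.Policy₂, G.retSim t x π₁ π₂

/-! ### Optimality equations -/

/-- The optimality equations of the sequential game, one for each sub-stage. -/
structure SeqOptimality (u₁ : (t : ℕ) → Occ₁ S A₁ A₂ Z₁ Z₂ t → ℝ)
    (u₂ : (t : ℕ) → Occ₂ S A₁ A₂ Z₁ Z₂ t → ℝ) : Prop where
  terminal : ∀ x ∈ G.X₁ G.ℓ, u₁ G.ℓ x = 0
  first : ∀ t < G.ℓ, ∀ x ∈ G.X₁ t,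
    IsGreatest (Set.range fun d₁ : DecRule A₁ Z₁ t => ρ₁ x d₁ + γ₁ * u₂ t (τ₁ x d₁)) (u₁ t x)
  second : ∀ t < G.ℓ, ∀ x ∈ G.X₂ t,
    IsLeast (Set.range fun d₂ : DecRule A₂ Z₂ t => G.ρ₂ x d₂ + G.γ₂ * u₁ (t + 1) (G.τ₂ x d₂))
      (u₂ t x)

/-- The optimality equations of the simultaneous game. -/
structure SimOptimality (u : (t : ℕ) → Occ₁ S A₁ A₂ Z₁ Z₂ t → ℝ) : Prop where
  terminal : ∀ x ∈ G.X₁ G.ℓ, u G.ℓ x = 0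
  stage : ∀ t < G.ℓ, ∀ x ∈ G.X₁ t,
    IsMaxMin (fun (d₁ : DecRule A₁ Z₁ t) (d₂ : DecRule A₂ Z₂ t) =>
      G.ρSim x d₁ d₂ + G.γ * u (t + 1) (G.τSim x d₁ d₂)) (u t x)

/-! ### Losslessness -/

/-- Value preservation. -/
structure ValuePreservation : Prop where
  /-- Every strategy profile has the return of the joint policy that it executes. -/
  seqReturn_eq : ∀ σ₁ σ₂, G.seqReturn σ₁ σ₂ = G.value (G.exec₁ σ₁) (G.exec₂ σ₂)
  /-- Every joint policy of the original game has the same return in the sequential game. -/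
  value_eq : ∀ π₁ π₂, ∃ σ₁ σ₂, G.exec₁ σ₁ = π₁ ∧ G.exec₂ σ₂ = π₂ ∧
    G.value π₁ π₂ = G.seqReturn σ₁ σ₂
  /-- Both games have a value, and it is the optimal sequential value of the initial state. -/
  maxMin : IsMaxMin G.value (G.vSeq₁ 0 G.x₀)
  minMax : IsMinMax G.value (G.vSeq₁ 0 G.x₀)
  maxMin_seq : IsMaxMin G.seqReturn (G.vSeq₁ 0 G.x₀)
  minMax_seq : IsMinMax G.seqReturn (G.vSeq₁ 0 G.x₀)
  /-- The terminal states record the returns. -/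
  termReturn_eq : ∀ π₁ π₂, G.termReturn (G.occ₁ π₁ π₂) = G.value π₁ π₂
  /-- The local processes pay the guaranteed returns, and their optimal values are the same value. -/
  local₁ : ∀ σ₁, IsLeast (Set.range fun π₂ => G.value (G.exec₁ σ₁) π₂)
    (G.ρLoc₁ (G.fam₁ (G.exec₁ σ₁)))
  local₂ : ∀ σ₂, IsGreatest (Set.range fun π₁ => G.value π₁ (G.exec₂ σ₂))
    (G.ρLoc₂ (G.famEnd₂ (G.exec₂ σ₂)))
  local_opt₁ : IsGreatest (Set.range fun σ₁ => G.ρLoc₁ (G.fam₁ (G.exec₁ σ₁))) (G.vSeq₁ 0 G.x₀)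
  local_opt₂ : IsLeast (Set.range fun σ₂ => G.ρLoc₂ (G.famEnd₂ (G.exec₂ σ₂))) (G.vSeq₁ 0 G.x₀)

/-- Equilibrium correspondence, through the executed policies. -/
structure EquilibriumCorrespondence : Prop where
  /-- Executing strategies maps onto the joint policies of the original game. -/
  surjective : Function.Surjective (Prod.map G.exec₁ G.exec₂)
  /-- A profile is an equilibrium if and only if the executed joint policy is one. -/
  preimage : equilibria G.seqReturn = Prod.map G.exec₁ G.exec₂ ⁻¹' equilibria G.value
  /-- The equilibria of the sequential game are mapped onto those of the original game. -/
  image : Prod.map G.exec₁ G.exec₂ '' equilibria G.seqReturn = equilibria G.value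

/-- Information-structure equivalence. -/
structure InformationEquivalence : Prop where
  /-- The central states generated by the sequential transitions are the true laws of the current
  state and the private histories (and the action of player 1) in the original game. -/
  state₁_eq : ∀ t ≤ G.ℓ, ∀ (θ₁ : RuleHist A₁ Z₁ t) (θ₂ : RuleHist A₂ Z₂ t),
    G.state₁ θ₁ θ₂ = G.occ₁ θ₁ θ₂
  state₂_eq : ∀ t < G.ℓ, ∀ (θ₁ : RuleHist A₁ Z₁ (t + 1)) (θ₂ : RuleHist A₂ Z₂ t),
    G.state₂ θ₁ θ₂ = G.occ₂ θ₁ θ₂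
  /-- The rewards are the conditional expected stage rewards. -/
  reward_eq : ∀ t < G.ℓ, ∀ (θ₁ : RuleHist A₁ Z₁ (t + 1)) (θ₂ : RuleHist A₂ Z₂ (t + 1)),
    G.ρ₂ (G.state₂ θ₁ θ₂.init) θ₂.last =
      ∑ w : Fin (t + 2) → S, ∑ h₁ : Hist A₁ Z₁ (t + 1), ∑ h₂ : Hist A₂ Z₂ (t + 1),
        G.trajProb θ₁ θ₂ w h₁ h₂ *
          G.r (w (Fin.last t).castSucc) (h₁ (Fin.last t)).1 (h₂ (Fin.last t)).1
  /-- Transition independence: a player's local state evolves by its own decision rules alone. -/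
  fam₁_snoc : ∀ t < G.ℓ, ∀ (θ₁ : RuleHist A₁ Z₁ t) (d₁ : DecRule A₁ Z₁ t),
    G.fam₁ (θ₁.snoc d₁) = G.τLoc₁ (G.fam₁ θ₁) d₁
  fam₂_snoc : ∀ t, t + 1 < G.ℓ → ∀ (θ₂ : RuleHist A₂ Z₂ t) (d₂ : DecRule A₂ Z₂ t),
    G.fam₂ (θ₂.snoc d₂) = G.τLoc₂ (G.fam₂ θ₂) d₂
  /-- No spurious information: a player's local state excludes none of the central states that some
  strategy of the opponent brings about, and contains no others. -/
  noInfo₁ : ∀ σ₁ t (ht : t ≤ G.ℓ),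
    G.fam₁ (G.playTo₁ σ₁ t ht) =
      Set.range fun σ₂ => G.state₁ (G.playTo₁ σ₁ t ht) (G.playTo₂ σ₂ t ht)
  noInfo₂ : ∀ σ₂ t (ht : t < G.ℓ),
    G.fam₂ (G.playTo₂ σ₂ t ht.le) =
      Set.range fun σ₁ => G.state₂ (G.playTo₁ σ₁ (t + 1) ht) (G.playTo₂ σ₂ t ht.le)
  noInfoEnd₂ : ∀ σ₂, G.famEnd₂ (G.exec₂ σ₂) =
    Set.range fun σ₁ => G.state₁ (G.exec₁ σ₁) (G.exec₂ σ₂)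
  /-- The two local states and the active decision rule determine the next central state. -/
  compatible₁ : ∀ t < G.ℓ, ∀ (θ₁ : RuleHist A₁ Z₁ t) (θ₂ : RuleHist A₂ Z₂ t)
    (d₁ : DecRule A₁ Z₁ t),
    φ₁ (G.fam₁ θ₁) (G.fam₂ θ₂) d₁ = {G.state₂ (θ₁.snoc d₁) θ₂}
  compatible₂ : ∀ t < G.ℓ, ∀ (θ₁ : RuleHist A₁ Z₁ (t + 1)) (θ₂ : RuleHist A₂ Z₂ t)
    (d₂ : DecRule A₂ Z₂ t),
    G.φ₂ (G.fam₂ θ₂) (G.fam₁ θ₁) d₂ = {G.state₁ θ₁ (θ₂.snoc d₂)}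
  /-- No strategically relevant distinction is collapsed: decision-rule histories with the same local
  state give the same central state against every opponent, -/
  noCollapse₁ : ∀ t ≤ G.ℓ, ∀ θ₁ θ₁' : RuleHist A₁ Z₁ t, G.fam₁ θ₁ = G.fam₁ θ₁' →
    ∀ θ₂ : RuleHist A₂ Z₂ t, G.occ₁ θ₁ θ₂ = G.occ₁ θ₁' θ₂
  noCollapse₂ : ∀ t < G.ℓ, ∀ θ₂ θ₂' : RuleHist A₂ Z₂ t, G.fam₂ θ₂ = G.fam₂ θ₂' →
    ∀ θ₁ : RuleHist A₁ Z₁ (t + 1), G.occ₂ θ₁ θ₂ = G.occ₂ θ₁ θ₂'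
  /-- and, when continued in the same way, the same return against every policy. -/
  sameReturn₁ : ∀ t (ht : t ≤ G.ℓ) (π₁ π₁' : G.Policy₁),
    G.fam₁ (π₁.take t ht) = G.fam₁ (π₁'.take t ht) →
    (∀ k : Fin G.ℓ, t ≤ k → π₁ k = π₁' k) → ∀ π₂, G.value π₁ π₂ = G.value π₁' π₂
  sameReturn₂ : ∀ t (ht : t < G.ℓ) (π₂ π₂' : G.Policy₂),
    G.fam₂ (π₂.take t ht.le) = G.fam₂ (π₂'.take t ht.le) →
    (∀ k : Fin G.ℓ, t ≤ k → π₂ k = π₂' k) → ∀ π₁, G.value π₁ π₂ = G.value π₁ π₂'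

/-- The sequential game is a lossless reduction of the original game. -/
structure IsLossless : Prop where
  values : G.ValuePreservation
  equilibria : G.EquilibriumCorrespondence
  information : G.InformationEquivalence

/-- Composing the two sub-stages of each stage recovers the simultaneous optimality equations. -/
structure RecoversSimultaneous : Prop where
  /-- The two sequential updates compose to the simultaneous one. -/
  transition : ∀ t < G.ℓ, ∀ x ∈ G.X₁ t, ∀ (d₁ : DecRule A₁ Z₁ t) (d₂ : DecRule A₂ Z₂ t),
    G.τ₂ (τ₁ x d₁) d₂ = G.τSim x d₁ d₂
  reward : ∀ t < G.ℓ, ∀ x ∈ G.X₁ t, ∀ (d₁ : DecRule A₁ Z₁ t) (d₂ : DecRule A₂ Z₂ t),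
    ρ₁ x d₁ + γ₁ * G.ρ₂ (τ₁ x d₁) d₂ = G.ρSim x d₁ d₂
  /-- The suprema and infima in the definition of the optimal values are attained. -/
  attained₁ : ∀ t ≤ G.ℓ, ∀ x ∈ G.X₁ t, IsMaxMin (G.ret₁ t x) (G.vSeq₁ t x)
  attained₂ : ∀ t < G.ℓ, ∀ x ∈ G.X₂ t, IsMaxMin (G.ret₂ t x) (G.vSeq₂ t x)
  attainedSim : ∀ t ≤ G.ℓ, ∀ x ∈ G.X₁ t, IsMaxMin (G.retSim t x) (G.vSim t x)
  /-- The optimal sequential values satisfy the sequential optimality equations, and at the stage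
  boundaries the simultaneous ones, where they are the optimal simultaneous values. -/
  seq_optimal : G.SeqOptimality G.vSeq₁ G.vSeq₂
  sim_optimal : G.SimOptimality G.vSeq₁
  value_eq : ∀ t ≤ G.ℓ, ∀ x ∈ G.X₁ t, G.vSeq₁ t x = G.vSim t x
  /-- The sequential equations compose to the simultaneous ones, and nothing is lost. -/
  compose : ∀ u₁ u₂, G.SeqOptimality u₁ u₂ → G.SimOptimality u₁
  decompose : ∀ u, G.SimOptimality u → ∃ u₂, G.SeqOptimality u u₂

end ZSPOSG

end

/-! Everything rests on perfect recall. Private histories contain the own actions, so a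
stage-boundary law factorises as `w₁(h₁) * w₂(h₂) * e(s, h₁, h₂)`: `wᵢ` is the product of player
`i`'s action probabilities along `hᵢ`, and `e` is built from the initial distribution and the kernel
alone (`state₁_eq_scale`). Two pairs of rule histories thus give the same state exactly when the
products `w₁ * w₂` agree on the pairs of histories that `e` charges (`state₁_eq_state₁_iff`). Since
action probabilities sum to one, this agreement passes to prefixes.

Two consequences carry the information structure and the function `g`. First, a state that arises
from `θ₁` against some opponent and from `θ₂` against some opponent is the state of `(θ₁, θ₂)`
(`SameWeights.cross`, `state₁_cross`). Hence compatible families meet in one point, and equal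
families cannot be told apart by any opponent. Second, a state determines the expected rewards of
all earlier stages (`partialValue_congr`). As it also determines the future under given rules, rule
histories with the same state are interchangeable.

The existence of a value is a minimax theorem. Mixing two policies in proportion to their
realisation weights makes the return affine in either policy, as in Kuhn's theorem
(`ret₁_mixPolicy_left`, `ret₁_mixPolicy_right`). With compactness and continuity this gives saddle
points (`exists_saddle_point`).

Strategies add nothing to policies: a player's sequence of families is determined by its own rules,
and constant strategies already execute every policy. Values and equilibria are therefore
transported along surjections.

For the optimality equations, the first sub-stage only splits a maximum. The second must move a
minimum past player 1's later choices, and this uses the saddle point. The remaining passage between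
sequential and simultaneous equations is the naming of the inner minimum as `u₂`. -/

set_option linter.unusedSectionVars false

/-! ### Compact zero-sum games -/

section CompactGames

variable {α β : Type*} [TopologicalSpace α] [TopologicalSpace β] {f : α → β → ℝ}

theorem isLeast_range_iInf [CompactSpace β] [Nonempty β] {g : β → ℝ} (hg : Continuous g) :
    IsLeast (Set.range g) (⨅ b, g b) :=
  (isCompact_range hg).isLeast_sInf (Set.range_nonempty g)

theorem isGreatest_range_iSup [CompactSpace β] [Nonempty β] {g : β → ℝ} (hg : Continuous g) :
    IsGreatest (Set.range g) (⨆ b, g b) :=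
  (isCompact_range hg).isGreatest_sSup (Set.range_nonempty g)

theorem continuous_iInf_of_compact [CompactSpace β]
    (hf : Continuous fun q : α × β => f q.1 q.2) :
    Continuous fun a => ⨅ b, f a b := by
  have h := isCompact_univ.continuous_sInf (K := (Set.univ : Set β)) (f := f) hf
  simp only [Set.image_univ] at h
  exact h

theorem isMaxMin_iSup_iInf [CompactSpace α] [Nonempty α] [CompactSpace β] [Nonempty β]
    (hf : Continuous fun q : α × β => f q.1 q.2) :
    IsMaxMin f (⨆ a, ⨅ b, f a b) :=
  ⟨fun a => ⨅ b, f a b, fun a => isLeast_range_iInf (hf.comp (Continuous.prodMk_right a)),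
    isGreatest_range_iSup (continuous_iInf_of_compact hf)⟩

/-- If no row keeps all columns above `v`, then some column keeps finitely many rows below `v`. -/
theorem exists_forall_mem_le [CompactSpace β] [Nonempty β]
    (hf : Continuous fun q : α × β => f q.1 q.2)
    (hα : ∀ (a a' : α) (c c' : ℝ), 0 ≤ c → 0 ≤ c' → c + c' = 1 →
      ∃ a'', ∀ b, f a'' b = c * f a b + c' * f a' b)
    (hβ : ∀ (b b' : β) (c c' : ℝ), 0 ≤ c → 0 ≤ c' → c + c' = 1 →
      ∃ b'', ∀ a, f a b'' = c * f a b + c' * f a b')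
    {v : ℝ} (hv : ∀ a, ∃ b, f a b ≤ v) (s : Finset α) : ∃ b, ∀ a ∈ s, f a b ≤ v := by
  classical
  by_contra hcon
  push Not at hcon
  -- Each column becomes its payoff vector on `s`. If the claim fails, the compact convex set of
  -- these vectors misses the closed orthant `L` below `v`, and a hyperplane separates the two.
  let F : β → s → ℝ := fun b a => f a b
  have hF : Continuous F := continuous_pi fun a => hf.comp (Continuous.prodMk_right a.1)
  let L : Set (s → ℝ) := {y | ∀ a, y a ≤ v}
  have hL : Convex ℝ L := by
    intro y hy z hz c c' hc hc' hcc a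
    have h1 := mul_le_mul_of_nonneg_left (hy a) hc
    have h2 := mul_le_mul_of_nonneg_left (hz a) hc'
    have h3 : v = c * v + c' * v := by rw [← add_mul, hcc, one_mul]
    simp only [Pi.add_apply, Pi.smul_apply, smul_eq_mul]
    linarith
  have hLc : IsClosed L := by
    have : L = ⋂ a, {y : s → ℝ | y a ≤ v} := by ext; simp [L]
    rw [this]
    exact isClosed_iInter fun a => isClosed_le (continuous_apply a) continuous_const
  have hK : Convex ℝ (Set.range F) := by
    rintro _ ⟨b, rfl⟩ _ ⟨b', rfl⟩ c c' hc hc' hcc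
    obtain ⟨b'', hb⟩ := hβ b b' c c' hc hc' hcc
    exact ⟨b'', funext fun a => hb a⟩
  have hdisj : Disjoint (Set.range F) L := by
    rw [Set.disjoint_left]
    rintro _ ⟨b, rfl⟩ hb
    obtain ⟨a, ha, h⟩ := hcon b
    exact absurd (hb ⟨a, ha⟩) (not_le.2 h)
  obtain ⟨g, u, w, hgK, huw, hgL⟩ :=
    geometric_hahn_banach_compact_closed hK (isCompact_range hF) hL hLc hdisj
  let c : s → ℝ := fun a => - g (Pi.single a 1)
  have hg : ∀ y : s → ℝ, g y = - ∑ a, y a * c a := by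
    intro y
    conv_lhs => rw [pi_eq_sum_univ' y]
    simp only [map_sum, map_smul, smul_eq_mul, c, mul_neg, Finset.sum_neg_distrib, neg_neg]
  -- `g` is bounded below on `L`, and `L` is unbounded in every direction `-e_a`; so `g` cannot
  -- decrease along `-e_a`.
  have hc : ∀ a, 0 ≤ c a := by
    intro a
    by_contra hneg
    push Not at hneg
    have hmem : ∀ n : ℝ, 0 ≤ n → (fun _ => v) - n • Pi.single a 1 ∈ L := by
      intro n hn j
      have : (0:ℝ) ≤ (Pi.single a 1 : s → ℝ) j := by
        by_cases h : j = a
        · subst h; simp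
        · simp [h]
      simp only [Pi.sub_apply, Pi.smul_apply, smul_eq_mul]
      nlinarith
    have h0 := hgL _ (hmem 0 le_rfl)
    -- The step length at which `g` would equal `w` exactly, against the strict separation.
    have hn : 0 ≤ (g (fun _ => v) - w) / (-c a) := by
      apply div_nonneg _ (by linarith)
      simp only [zero_smul, sub_zero] at h0
      linarith
    have h1 := hgL _ (hmem _ hn)
    rw [map_sub, map_smul, smul_eq_mul] at h1
    have h2 : g (Pi.single a 1) = - c a := by simp [c]
    rw [h2, div_mul_cancel₀ _ (by linarith : - c a ≠ 0)] at h1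
    linarith
  have hlt : ∀ b, v * ∑ a, c a < ∑ a : s, f a b * c a := by
    intro b
    have h1 := hgK _ ⟨b, rfl⟩
    have h2 := hgL (fun _ => v) (fun _ => le_rfl)
    rw [hg] at h1 h2
    rw [Finset.mul_sum]
    have : ∑ a : s, F b a * c a = ∑ a : s, f a b * c a := rfl
    linarith
  have hsum : 0 < ∑ a, c a := by
    refine lt_of_le_of_ne (Finset.sum_nonneg fun a _ => hc a) fun h0 => ?_
    have hz : ∀ a, c a = 0 := fun a =>
      (Finset.sum_eq_zero_iff_of_nonneg fun a _ => hc a).1 h0.symm a (Finset.mem_univ a)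
    have := hlt (Classical.arbitrary β)
    simp [hz] at this
  have hrow : Convex ℝ (Set.range f) := by
    rintro _ ⟨a, rfl⟩ _ ⟨a', rfl⟩ c c' hc hc' hcc
    obtain ⟨a'', ha⟩ := hα a a' c c' hc hc' hcc
    exact ⟨a'', funext fun b => ha b⟩
  -- The normalised normal vector is a mixed strategy over `s`. A single row realises it against all
  -- columns and stays above `v` everywhere, contrary to `hv`.
  obtain ⟨a, ha⟩ := hrow.sum_mem (t := Finset.univ) (w := fun a : s => c a / ∑ a, c a)
    (z := fun a : s => f a) (fun a _ => div_nonneg (hc a) hsum.le)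
    (by rw [← Finset.sum_div, div_self hsum.ne']) (fun a _ => ⟨a, rfl⟩)
  obtain ⟨b, hb⟩ := hv a
  have h1 := congrFun ha b
  rw [Finset.sum_apply] at h1
  have h2 : ∑ i : s, ((c i / ∑ a, c a) • f i) b = (∑ i : s, f i b * c i) / ∑ a, c a := by
    rw [Finset.sum_div]
    refine Finset.sum_congr rfl fun i _ => ?_
    simp only [Pi.smul_apply, smul_eq_mul]
    ring
  rw [h2] at h1
  have h3 := (lt_div_iff₀ hsum).2 (hlt b)
  linarith

/-- The minimax theorem for compact zero-sum games in which mixing is possible for both players. -/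
theorem exists_saddle_point [CompactSpace α] [Nonempty α] [CompactSpace β] [Nonempty β]
    (hf : Continuous fun q : α × β => f q.1 q.2)
    (hα : ∀ (a a' : α) (c c' : ℝ), 0 ≤ c → 0 ≤ c' → c + c' = 1 →
      ∃ a'', ∀ b, f a'' b = c * f a b + c' * f a' b)
    (hβ : ∀ (b b' : β) (c c' : ℝ), 0 ≤ c → 0 ≤ c' → c + c' = 1 →
      ∃ b'', ∀ a, f a b'' = c * f a b + c' * f a b') :
    ∃ a b, (∀ a', f a' b ≤ ⨆ a, ⨅ b, f a b) ∧ ∀ b', ⨆ a, ⨅ b, f a b ≤ f a b' := by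
  obtain ⟨m, hm, ⟨a, ha⟩, hmax⟩ := isMaxMin_iSup_iInf hf
  have hv : ∀ a, ∃ b, f a b ≤ ⨆ a, ⨅ b, f a b := fun a => by
    obtain ⟨b, hb⟩ := (hm a).1
    exact ⟨b, hb.le.trans (hmax ⟨a, rfl⟩)⟩
  -- Compactness upgrades the finite statement to one column that holds every row down to the
  -- max–min value.
  obtain ⟨b, hb⟩ : (⋂ a, {b | f a b ≤ ⨆ a, ⨅ b, f a b}).Nonempty := by
    refine CompactSpace.iInter_nonempty
      (fun a => isClosed_le (hf.comp (Continuous.prodMk_right a)) continuous_const) fun s => ?_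
    obtain ⟨b, hb⟩ := exists_forall_mem_le hf hα hβ hv s
    exact ⟨b, by simpa using hb⟩
  exact ⟨a, b, fun a' => Set.mem_iInter.1 hb a', fun b' => ha ▸ (hm a).2 ⟨b', rfl⟩⟩

theorem isMinMax_of_saddle_point [CompactSpace α] [Nonempty α]
    (hf : Continuous fun q : α × β => f q.1 q.2) {v : ℝ} {a : α} {b : β}
    (ha : ∀ b', v ≤ f a b') (hb : ∀ a', f a' b ≤ v) : IsMinMax f v := by
  have hm : ∀ b, IsGreatest (Set.range fun a => f a b) (⨆ a, f a b) := fun b =>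
    isGreatest_range_iSup (hf.comp (Continuous.prodMk_left b))
  refine ⟨fun b => ⨆ a, f a b, hm, ⟨b, le_antisymm ?_ ((ha b).trans ((hm b).2 ⟨a, rfl⟩))⟩, ?_⟩
  · obtain ⟨a', h⟩ := (hm b).1
    exact h.symm.le.trans (hb a')
  · rintro _ ⟨b', rfl⟩
    exact (ha b').trans ((hm b').2 ⟨a, rfl⟩)

end CompactGames

noncomputable section

/-! ### Extending histories -/

namespace Hist

variable {A Z : Type*} {t : ℕ}

/-- Append an action and an observation to a private history. -/
def snoc (h : Hist A Z t) (a : A) (z : Z) : Hist A Z (t + 1) :=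
  Fin.snoc (α := fun _ => A × Z) h (a, z)

@[simp]
theorem snoc_last (h : Hist A Z t) (a : A) (z : Z) : h.snoc a z (Fin.last t) = (a, z) :=
  Fin.snoc_last (α := fun _ => A × Z) _ _

@[simp]
theorem take_snoc (h : Hist A Z t) (a : A) (z : Z) (ht : t ≤ t + 1) : (h.snoc a z).take t ht = h :=
  funext fun k => Fin.snoc_castSucc (α := fun _ => A × Z) (a, z) h k

end Hist

theorem sum_fin_succ_eq_sum_snoc {X : Type*} [Fintype X] {t : ℕ} (F : (Fin (t + 1) → X) → ℝ) :
    ∑ w, F w = ∑ w : Fin t → X, ∑ x : X, F (Fin.snoc (α := fun _ => X) w x) := by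
  rw [← (Fin.snocEquiv fun _ : Fin (t + 1) => X).sum_comp, Fintype.sum_prod_type, Finset.sum_comm]
  rfl

theorem Hist.sum_eq_sum_snoc {A Z : Type*} [Fintype A] [Fintype Z] {t : ℕ}
    (F : Hist A Z (t + 1) → ℝ) :
    ∑ h, F h = ∑ h : Hist A Z t, ∑ a : A, ∑ z : Z, F (h.snoc a z) := by
  rw [sum_fin_succ_eq_sum_snoc]
  simp_rw [Fintype.sum_prod_type]
  rfl

namespace RuleHist

variable {A Z : Type*} [Fintype A] {t : ℕ}

@[simp]
theorem init_snoc (θ : RuleHist A Z t) (d : DecRule A Z t) : (θ.snoc d).init = θ :=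
  Fin.init_snoc (α := fun k : Fin (t + 1) => DecRule A Z k) d θ

@[simp]
theorem last_snoc (θ : RuleHist A Z t) (d : DecRule A Z t) : (θ.snoc d).last = d :=
  Fin.snoc_last (α := fun k : Fin (t + 1) => DecRule A Z k) d θ

theorem snoc_init_last (θ : RuleHist A Z (t + 1)) : θ.init.snoc θ.last = θ :=
  Fin.snoc_init_self (α := fun k : Fin (t + 1) => DecRule A Z k) θ

end RuleHist

/-- The weights `w` of histories, carried over one stage by a decision rule. -/
def extendWeight {A Z : Type*} [Fintype A] {t : ℕ} (w : Hist A Z t → ℝ) (d : DecRule A Z t) :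
    Hist A Z (t + 1) → ℝ :=
  fun h => w (h.take t t.le_succ) * d (h.take t t.le_succ) (h (Fin.last t)).1

/-- The realisation weight of a private history: the product of the probabilities of the own
actions. -/
def weight {A Z : Type*} [Fintype A] : {t : ℕ} → RuleHist A Z t → Hist A Z t → ℝ
  | 0, _ => fun _ => 1
  | _ + 1, θ => extendWeight (weight θ.init) θ.last

theorem weight_snoc {A Z : Type*} [Fintype A] {t : ℕ} (θ : RuleHist A Z (t + 1)) (h : Hist A Z t)
    (a : A) (z : Z) : weight θ (h.snoc a z) = weight θ.init h * θ.last h a := by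
  simp [weight, extendWeight]

namespace ZSPOSG

variable {S A₁ A₂ Z₁ Z₂ : Type*} [Fintype S] [Fintype A₁] [Fintype A₂] [Fintype Z₁] [Fintype Z₂]
variable (G : ZSPOSG S A₁ A₂ Z₁ Z₂)

/-! ### Factorisation of the central states -/

/-- Multiply an occupancy by weights of the private histories. -/
def scale {t : ℕ} (w₁ : Hist A₁ Z₁ t → ℝ) (w₂ : Hist A₂ Z₂ t → ℝ) (x : Occ₁ S A₁ A₂ Z₁ Z₂ t) :
    Occ₁ S A₁ A₂ Z₁ Z₂ t :=
  fun s h₁ h₂ => w₁ h₁ * w₂ h₂ * x s h₁ h₂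

/-- One transition, without the probabilities of the actions. -/
def envStep {t : ℕ} (x : Occ₁ S A₁ A₂ Z₁ Z₂ t) : Occ₁ S A₁ A₂ Z₁ Z₂ (t + 1) :=
  fun s' h₁ h₂ => ∑ s : S, x s (h₁.take t t.le_succ) (h₂.take t t.le_succ) *
    G.p s (h₁ (Fin.last t)).1 (h₂ (Fin.last t)).1 (s', (h₁ (Fin.last t)).2, (h₂ (Fin.last t)).2)

/-- The part of the central states that does not depend on the decision rules. -/
def env : (t : ℕ) → Occ₁ S A₁ A₂ Z₁ Z₂ t
  | 0 => G.x₀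
  | t + 1 => G.envStep (env t)

theorem τ₂_τ₁_scale {t : ℕ} (w₁ : Hist A₁ Z₁ t → ℝ) (w₂ : Hist A₂ Z₂ t → ℝ)
    (x : Occ₁ S A₁ A₂ Z₁ Z₂ t) (d₁ : DecRule A₁ Z₁ t) (d₂ : DecRule A₂ Z₂ t) :
    G.τ₂ (τ₁ (scale w₁ w₂ x) d₁) d₂ =
      scale (extendWeight w₁ d₁) (extendWeight w₂ d₂) (G.envStep x) := by
  funext s' h₁ h₂
  simp only [τ₂, τ₁, scale, extendWeight, envStep, Finset.mul_sum]
  exact Finset.sum_congr rfl fun s _ => by ring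

/-- Each rule reads only the own history and multiplies by a factor that does not involve the hidden
state, so it can be pulled out of the sum over states. -/
theorem state₁_eq_scale {t : ℕ} (θ₁ : RuleHist A₁ Z₁ t) (θ₂ : RuleHist A₂ Z₂ t) :
    G.state₁ θ₁ θ₂ = scale (weight θ₁) (weight θ₂) (G.env t) := by
  induction t with
  | zero => funext s h₁ h₂; simp [state₁, scale, weight, env]
  | succ t ih => rw [state₁, ih, τ₂_τ₁_scale]; rfl

theorem env_nonneg (t : ℕ) (s : S) (h₁ : Hist A₁ Z₁ t) (h₂ : Hist A₂ Z₂ t) :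
    0 ≤ G.env t s h₁ h₂ := by
  induction t generalizing s with
  | zero => exact G.b.2.1 s
  | succ t ih => exact Finset.sum_nonneg fun s _ => mul_nonneg (ih _ _ _) ((G.p _ _ _).2.1 _)

/-- The histories `h₁, h₂` have positive probability under suitable decision rules. -/
def Reachable {t : ℕ} (h₁ : Hist A₁ Z₁ t) (h₂ : Hist A₂ Z₂ t) : Prop :=
  ∑ s, G.env t s h₁ h₂ ≠ 0

theorem reachable_iff {t : ℕ} {h₁ : Hist A₁ Z₁ t} {h₂ : Hist A₂ Z₂ t} :
    G.Reachable h₁ h₂ ↔ ∃ s, G.env t s h₁ h₂ ≠ 0 := by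
  rw [Reachable, Ne, Finset.sum_eq_zero_iff_of_nonneg fun s _ => G.env_nonneg t s h₁ h₂]
  simp

theorem sum_kernel (s : S) (a₁ : A₁) (a₂ : A₂) :
    ∑ z₁, ∑ z₂, ∑ s', G.p s a₁ a₂ (s', z₁, z₂) = 1 := by
  have h := stdSimplex.sum_eq_one (G.p s a₁ a₂)
  rw [Fintype.sum_prod_type, Finset.sum_comm, Fintype.sum_prod_type] at h
  exact h

theorem Reachable.take {t : ℕ} {h₁ : Hist A₁ Z₁ (t + 1)} {h₂ : Hist A₂ Z₂ (t + 1)}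
    (h : G.Reachable h₁ h₂) : G.Reachable (h₁.take t t.le_succ) (h₂.take t t.le_succ) := by
  rw [reachable_iff] at h ⊢
  obtain ⟨s', h⟩ := h
  obtain ⟨s, -, hs⟩ := Finset.exists_ne_zero_of_sum_ne_zero h
  exact ⟨s, left_ne_zero_of_mul hs⟩

/-- The kernel has total mass one, so for fixed actions the masses of the one-step extensions add up
to the mass of the pair, and they cannot all vanish. -/
theorem Reachable.exists_snoc {t : ℕ} {h₁ : Hist A₁ Z₁ t} {h₂ : Hist A₂ Z₂ t}
    (h : G.Reachable h₁ h₂) (a₁ : A₁) (a₂ : A₂) :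
    ∃ z₁ z₂, G.Reachable (h₁.snoc a₁ z₁) (h₂.snoc a₂ z₂) := by
  have hsum : ∑ z₁, ∑ z₂, ∑ s', G.env (t + 1) s' (h₁.snoc a₁ z₁) (h₂.snoc a₂ z₂) =
      ∑ s, G.env t s h₁ h₂ := by
    simp only [env, envStep, Hist.take_snoc, Hist.snoc_last]
    calc _ = ∑ s, G.env t s h₁ h₂ * ∑ z₁, ∑ z₂, ∑ s', G.p s a₁ a₂ (s', z₁, z₂) := by
          simp_rw [Finset.mul_sum]
          symm
          rw [Finset.sum_comm]
          refine Finset.sum_congr rfl fun z₁ _ => ?_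
          rw [Finset.sum_comm]
          exact Finset.sum_congr rfl fun z₂ _ => Finset.sum_comm
      _ = _ := by simp_rw [sum_kernel, mul_one]
  rw [Reachable, ← hsum] at h
  obtain ⟨z₁, -, h⟩ := Finset.exists_ne_zero_of_sum_ne_zero h
  obtain ⟨z₂, -, h⟩ := Finset.exists_ne_zero_of_sum_ne_zero h
  exact ⟨z₁, z₂, h⟩

/-- The decision-rule histories give the same weights to all reachable pairs of histories. -/
def SameWeights {t : ℕ} (θ₁ : RuleHist A₁ Z₁ t) (θ₂ : RuleHist A₂ Z₂ t) (θ₁' : RuleHist A₁ Z₁ t)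
    (θ₂' : RuleHist A₂ Z₂ t) : Prop :=
  ∀ h₁ h₂, G.Reachable h₁ h₂ →
    weight θ₁ h₁ * weight θ₂ h₂ = weight θ₁' h₁ * weight θ₂' h₂

theorem state₁_eq_state₁_iff {t : ℕ} {θ₁ θ₁' : RuleHist A₁ Z₁ t} {θ₂ θ₂' : RuleHist A₂ Z₂ t} :
    G.state₁ θ₁ θ₂ = G.state₁ θ₁' θ₂' ↔ G.SameWeights θ₁ θ₂ θ₁' θ₂' := by
  rw [state₁_eq_scale, state₁_eq_scale]
  constructor
  · intro h h₁ h₂ hr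
    obtain ⟨s, hs⟩ := G.reachable_iff.1 hr
    exact mul_right_cancel₀ hs (congrFun (congrFun (congrFun h s) h₁) h₂)
  · intro h
    funext s h₁ h₂
    by_cases hs : G.env t s h₁ h₂ = 0
    · simp [scale, hs]
    · simp [scale, h h₁ h₂ (G.reachable_iff.2 ⟨s, hs⟩)]

theorem SameWeights.mul_rule {t : ℕ} {θ₁ θ₁' : RuleHist A₁ Z₁ (t + 1)}
    {θ₂ θ₂' : RuleHist A₂ Z₂ (t + 1)} (h : G.SameWeights θ₁ θ₂ θ₁' θ₂') {h₁ : Hist A₁ Z₁ t}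
    {h₂ : Hist A₂ Z₂ t} (hr : G.Reachable h₁ h₂) (a₁ : A₁) (a₂ : A₂) :
    weight θ₁.init h₁ * θ₁.last h₁ a₁ * (weight θ₂.init h₂ * θ₂.last h₂ a₂) =
      weight θ₁'.init h₁ * θ₁'.last h₁ a₁ * (weight θ₂'.init h₂ * θ₂'.last h₂ a₂) := by
  obtain ⟨z₁, z₂, hz⟩ := hr.exists_snoc G a₁ a₂
  simpa only [weight_snoc] using h _ _ hz

/-- Summing out player 1's last action isolates player 2's last rule; `SameWeights.cross` needs
exactly this. -/
theorem SameWeights.sum_left {t : ℕ} {θ₁ θ₁' : RuleHist A₁ Z₁ (t + 1)}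
    {θ₂ θ₂' : RuleHist A₂ Z₂ (t + 1)} (h : G.SameWeights θ₁ θ₂ θ₁' θ₂') {h₁ : Hist A₁ Z₁ t}
    {h₂ : Hist A₂ Z₂ t} (hr : G.Reachable h₁ h₂) (a₂ : A₂) :
    weight θ₁.init h₁ * (weight θ₂.init h₂ * θ₂.last h₂ a₂) =
      weight θ₁'.init h₁ * (weight θ₂'.init h₂ * θ₂'.last h₂ a₂) := by
  have := Finset.sum_congr rfl fun a₁ (_ : a₁ ∈ Finset.univ) => h.mul_rule G hr a₁ a₂
  simpa only [← Finset.sum_mul, ← Finset.mul_sum, stdSimplex.sum_eq_one, mul_one] using this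

theorem SameWeights.init {t : ℕ} {θ₁ θ₁' : RuleHist A₁ Z₁ (t + 1)}
    {θ₂ θ₂' : RuleHist A₂ Z₂ (t + 1)} (h : G.SameWeights θ₁ θ₂ θ₁' θ₂') :
    G.SameWeights θ₁.init θ₂.init θ₁'.init θ₂'.init := by
  intro h₁ h₂ hr
  have := Finset.sum_congr rfl fun a₂ (_ : a₂ ∈ Finset.univ) => h.sum_left G hr a₂
  simpa only [← Finset.mul_sum, stdSimplex.sum_eq_one, mul_one] using this

/-- If a law arises from `θ₁` against some opponent and from `θ₂` against some opponent, then it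
arises from `θ₁` against `θ₂`. -/
theorem SameWeights.cross {t : ℕ} {θ₁ θ₁' : RuleHist A₁ Z₁ t} {θ₂ θ₂' : RuleHist A₂ Z₂ t}
    (h : G.SameWeights θ₁ θ₂' θ₁' θ₂) : G.SameWeights θ₁ θ₂ θ₁ θ₂' := by
  induction t with
  | zero => intro h₁ h₂ _; simp [weight]
  | succ t ih =>
    intro h₁ h₂ hr
    have h0 := hr.take G
    have e1 := ih (h.init G) _ _ h0
    have e2 := h.init G _ _ h0
    have e3 := h.sum_left G h0 (h₂ (Fin.last t)).1
    simp only [weight, extendWeight]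
    generalize weight θ₁.init (h₁.take t t.le_succ) = r₁ at *
    generalize weight θ₂.init (h₂.take t t.le_succ) = r₂ at *
    generalize weight θ₁'.init (h₁.take t t.le_succ) = r₁' at *
    generalize weight θ₂'.init (h₂.take t t.le_succ) = r₂' at *
    -- With `q, q'` the last action probabilities of `θ₂, θ₂'`: `r₁ r₂ q = r₁' r₂ q` by `e1` and
    -- `e2`, and `r₁' r₂ q = r₁ r₂' q'` by `e3`. Both sides then carry player 1's common factor.
    linear_combination θ₁.last (h₁.take t t.le_succ) (h₁ (Fin.last t)).1 *
      (θ₂.last (h₂.take t t.le_succ) (h₂ (Fin.last t)).1 * (e1 + e2) - e3)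

theorem state₁_cross {t : ℕ} {θ₁ θ₁' : RuleHist A₁ Z₁ t} {θ₂ θ₂' : RuleHist A₂ Z₂ t}
    (h : G.state₁ θ₁ θ₂' = G.state₁ θ₁' θ₂) : G.state₁ θ₁ θ₂ = G.state₁ θ₁ θ₂' :=
  G.state₁_eq_state₁_iff.2 ((G.state₁_eq_state₁_iff.1 h).cross G)

/-- Equal central states come from equal expected rewards in the stage before. -/
theorem ρ₂_state₂_congr {t : ℕ} {θ₁ θ₁' : RuleHist A₁ Z₁ (t + 1)} {θ₂ θ₂' : RuleHist A₂ Z₂ (t + 1)}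
    (h : G.state₁ θ₁ θ₂ = G.state₁ θ₁' θ₂') :
    G.ρ₂ (G.state₂ θ₁ θ₂.init) θ₂.last = G.ρ₂ (G.state₂ θ₁' θ₂'.init) θ₂'.last := by
  rw [state₁_eq_state₁_iff] at h
  simp only [ρ₂, state₂, τ₁, state₁_eq_scale, scale]
  refine Finset.sum_congr rfl fun s _ => Finset.sum_congr rfl fun h₁ _ =>
    Finset.sum_congr rfl fun h₂ _ => Finset.sum_congr rfl fun a₁ _ =>
    Finset.sum_congr rfl fun a₂ _ => ?_
  by_cases hs : G.env t s h₁ h₂ = 0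
  · simp [hs]
  · linear_combination G.env t s h₁ h₂ * G.r s a₁ a₂ *
      h.mul_rule G (G.reachable_iff.2 ⟨s, hs⟩) a₁ a₂

theorem state₁_init_congr {t : ℕ} {θ₁ θ₁' : RuleHist A₁ Z₁ (t + 1)} {θ₂ θ₂' : RuleHist A₂ Z₂ (t + 1)}
    (h : G.state₁ θ₁ θ₂ = G.state₁ θ₁' θ₂') :
    G.state₁ θ₁.init θ₂.init = G.state₁ θ₁'.init θ₂'.init :=
  G.state₁_eq_state₁_iff.2 ((G.state₁_eq_state₁_iff.1 h).init G)

theorem sum_τ₁ {t : ℕ} (x : Occ₁ S A₁ A₂ Z₁ Z₂ t) (d₁ : DecRule A₁ Z₁ t) (s : S)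
    (h₁ : Hist A₁ Z₁ t) (h₂ : Hist A₂ Z₂ t) : ∑ a₁, τ₁ x d₁ s h₁ h₂ a₁ = x s h₁ h₂ := by
  simp only [τ₁, ← Finset.mul_sum, stdSimplex.sum_eq_one, mul_one]

/-- The transition at `(1,t)` loses no information about the central state. -/
theorem eq_of_τ₁_eq {t : ℕ} {x x' : Occ₁ S A₁ A₂ Z₁ Z₂ t} {d₁ d₁' : DecRule A₁ Z₁ t}
    (h : τ₁ x d₁ = τ₁ x' d₁') : x = x' := by
  funext s h₁ h₂
  rw [← sum_τ₁ x d₁, h, sum_τ₁]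

end ZSPOSG

end

noncomputable section

namespace ZSPOSG

variable {S A₁ A₂ Z₁ Z₂ : Type*} [Fintype S] [Fintype A₁] [Fintype A₂] [Fintype Z₁] [Fintype Z₂]
variable (G : ZSPOSG S A₁ A₂ Z₁ Z₂)

/-! ### The laws in the original game -/

theorem trajProb_succ {t : ℕ} (θ₁ : RuleHist A₁ Z₁ (t + 1)) (θ₂ : RuleHist A₂ Z₂ (t + 1))
    (w : Fin (t + 2) → S) (h₁ : Hist A₁ Z₁ (t + 1)) (h₂ : Hist A₂ Z₂ (t + 1)) :
    G.trajProb θ₁ θ₂ w h₁ h₂ =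
      G.trajProb θ₁.init θ₂.init (fun k => w k.castSucc) (h₁.take t t.le_succ)
        (h₂.take t t.le_succ) *
      (θ₁.last (h₁.take t t.le_succ) (h₁ (Fin.last t)).1 *
        θ₂.last (h₂.take t t.le_succ) (h₂ (Fin.last t)).1 *
        G.p (w (Fin.last t).castSucc) (h₁ (Fin.last t)).1 (h₂ (Fin.last t)).1
          (w (Fin.last (t + 1)), (h₁ (Fin.last t)).2, (h₂ (Fin.last t)).2)) := by
  simp only [trajProb]
  rw [Fin.prod_univ_castSucc, ← mul_assoc]
  rfl

theorem trajProb_snoc {t : ℕ} (θ₁ : RuleHist A₁ Z₁ (t + 1)) (θ₂ : RuleHist A₂ Z₂ (t + 1))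
    (w : Fin (t + 1) → S) (s' : S) (h₁ : Hist A₁ Z₁ (t + 1)) (h₂ : Hist A₂ Z₂ (t + 1)) :
    G.trajProb θ₁ θ₂ (Fin.snoc (α := fun _ => S) w s') h₁ h₂ =
      G.trajProb θ₁.init θ₂.init w (h₁.take t t.le_succ) (h₂.take t t.le_succ) *
      (θ₁.last (h₁.take t t.le_succ) (h₁ (Fin.last t)).1 *
        θ₂.last (h₂.take t t.le_succ) (h₂ (Fin.last t)).1 *
        G.p (w (Fin.last t)) (h₁ (Fin.last t)).1 (h₂ (Fin.last t)).1
          (s', (h₁ (Fin.last t)).2, (h₂ (Fin.last t)).2)) := by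
  rw [trajProb_succ]
  simp only [Fin.snoc_castSucc (α := fun _ => S), Fin.snoc_last (α := fun _ => S)]

theorem state₁_eq_occ₁ {t : ℕ} (θ₁ : RuleHist A₁ Z₁ t) (θ₂ : RuleHist A₂ Z₂ t) :
    G.state₁ θ₁ θ₂ = G.occ₁ θ₁ θ₂ := by
  induction t with
  | zero =>
    funext s h₁ h₂
    simp only [state₁, x₀, occ₁, trajProb, Finset.univ_eq_empty, Finset.prod_empty, mul_one,
      Finset.univ_unique, Finset.sum_singleton]
    rfl
  | succ t ih =>
    funext s' h₁ h₂
    rw [state₁, ih]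
    simp only [occ₁, τ₂, τ₁, trajProb_snoc]
    rw [sum_fin_succ_eq_sum_snoc, Finset.sum_comm]
    refine Finset.sum_congr rfl fun s _ => ?_
    simp only [Fin.snoc_last (α := fun _ => S), Finset.sum_mul]
    exact Finset.sum_congr rfl fun w _ => by ring

theorem state₂_eq_occ₂ {t : ℕ} (θ₁ : RuleHist A₁ Z₁ (t + 1)) (θ₂ : RuleHist A₂ Z₂ t) :
    G.state₂ θ₁ θ₂ = G.occ₂ θ₁ θ₂ := by
  funext s h₁ h₂ a₁
  simp only [state₂, state₁_eq_occ₁, τ₁, occ₁, occ₂, Finset.sum_mul]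

/-- Moves the observations and the next state innermost, in the order in which `sum_kernel` sums the
kernel to one. -/
theorem sum_reorder {X H₁ H₂ B₁ B₂ Y₁ Y₂ : Type*} [Fintype X] [Fintype H₁] [Fintype H₂] [Fintype B₁]
    [Fintype B₂] [Fintype Y₁] [Fintype Y₂] (f : X → H₁ → B₁ → Y₁ → H₂ → B₂ → Y₂ → ℝ) :
    ∑ x, ∑ h₁, ∑ b₁, ∑ y₁, ∑ h₂, ∑ b₂, ∑ y₂, f x h₁ b₁ y₁ h₂ b₂ y₂ =
      ∑ h₁, ∑ h₂, ∑ b₁, ∑ b₂, ∑ y₁, ∑ y₂, ∑ x, f x h₁ b₁ y₁ h₂ b₂ y₂ := by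
  refine Finset.sum_comm.trans (Finset.sum_congr rfl fun h₁ _ => ?_)
  refine (Finset.sum_comm.trans (Finset.sum_congr rfl fun b₁ _ => ?_)).trans Finset.sum_comm
  have r : ∑ h₂, ∑ b₂, ∑ y₁, ∑ y₂, ∑ x, f x h₁ b₁ y₁ h₂ b₂ y₂ =
      ∑ y₁, ∑ h₂, ∑ b₂, ∑ y₂, ∑ x, f x h₁ b₁ y₁ h₂ b₂ y₂ :=
    (Finset.sum_congr rfl fun h₂ _ => Finset.sum_comm).trans Finset.sum_comm
  refine (Finset.sum_comm.trans (Finset.sum_congr rfl fun y₁ _ => ?_)).trans r.symm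
  refine Finset.sum_comm.trans (Finset.sum_congr rfl fun h₂ _ => ?_)
  exact Finset.sum_comm.trans (Finset.sum_congr rfl fun b₂ _ => Finset.sum_comm)

/-- The next state and the observations are summed out. -/
theorem sum_trajProb_succ {t : ℕ} (θ₁ : RuleHist A₁ Z₁ (t + 1)) (θ₂ : RuleHist A₂ Z₂ (t + 1))
    (F : (Fin (t + 1) → S) → Hist A₁ Z₁ t → Hist A₂ Z₂ t → A₁ → A₂ → ℝ) :
    ∑ w : Fin (t + 2) → S, ∑ h₁ : Hist A₁ Z₁ (t + 1), ∑ h₂ : Hist A₂ Z₂ (t + 1),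
      G.trajProb θ₁ θ₂ w h₁ h₂ * F (fun k => w k.castSucc) (h₁.take t t.le_succ)
        (h₂.take t t.le_succ) (h₁ (Fin.last t)).1 (h₂ (Fin.last t)).1 =
    ∑ w : Fin (t + 1) → S, ∑ h₁ : Hist A₁ Z₁ t, ∑ h₂ : Hist A₂ Z₂ t,
      G.trajProb θ₁.init θ₂.init w h₁ h₂ *
        ∑ a₁, ∑ a₂, θ₁.last h₁ a₁ * θ₂.last h₂ a₂ * F w h₁ h₂ a₁ a₂ := by
  rw [sum_fin_succ_eq_sum_snoc]
  refine Finset.sum_congr rfl fun w _ => ?_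
  simp_rw [Hist.sum_eq_sum_snoc, trajProb_snoc, Hist.take_snoc, Hist.snoc_last,
    Fin.snoc_castSucc (α := fun _ => S)]
  rw [sum_reorder]
  refine Finset.sum_congr rfl fun h₁ _ => Finset.sum_congr rfl fun h₂ _ => ?_
  rw [Finset.mul_sum]
  refine Finset.sum_congr rfl fun a₁ _ => ?_
  rw [Finset.mul_sum]
  refine Finset.sum_congr rfl fun a₂ _ => ?_
  simp_rw [← Finset.sum_mul, ← Finset.mul_sum, sum_kernel]
  ring

theorem sum_trajProb_last {t : ℕ} (θ₁ : RuleHist A₁ Z₁ t) (θ₂ : RuleHist A₂ Z₂ t)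
    (F : S → Hist A₁ Z₁ t → Hist A₂ Z₂ t → ℝ) :
    ∑ w : Fin (t + 1) → S, ∑ h₁ : Hist A₁ Z₁ t, ∑ h₂ : Hist A₂ Z₂ t,
      G.trajProb θ₁ θ₂ w h₁ h₂ * F (w (Fin.last t)) h₁ h₂ =
    ∑ s, ∑ h₁, ∑ h₂, G.occ₁ θ₁ θ₂ s h₁ h₂ * F s h₁ h₂ := by
  rw [sum_fin_succ_eq_sum_snoc, Finset.sum_comm]
  refine Finset.sum_congr rfl fun s _ => ?_
  rw [Finset.sum_comm]
  refine Finset.sum_congr rfl fun h₁ _ => ?_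
  rw [Finset.sum_comm]
  refine Finset.sum_congr rfl fun h₂ _ => ?_
  simp only [occ₁, Finset.sum_mul, Fin.snoc_last (α := fun _ => S)]

theorem ρ₂_state₂_eq {t : ℕ} (θ₁ : RuleHist A₁ Z₁ (t + 1)) (θ₂ : RuleHist A₂ Z₂ (t + 1)) :
    G.ρ₂ (G.state₂ θ₁ θ₂.init) θ₂.last =
      ∑ w : Fin (t + 2) → S, ∑ h₁ : Hist A₁ Z₁ (t + 1), ∑ h₂ : Hist A₂ Z₂ (t + 1),
        G.trajProb θ₁ θ₂ w h₁ h₂ *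
          G.r (w (Fin.last t).castSucc) (h₁ (Fin.last t)).1 (h₂ (Fin.last t)).1 := by
  rw [G.sum_trajProb_succ θ₁ θ₂ fun w _ _ a₁ a₂ => G.r (w (Fin.last t)) a₁ a₂,
    G.sum_trajProb_last θ₁.init θ₂.init fun s h₁ h₂ =>
      ∑ a₁, ∑ a₂, θ₁.last h₁ a₁ * θ₂.last h₂ a₂ * G.r s a₁ a₂]
  simp only [ρ₂, state₂, τ₁, state₁_eq_occ₁, Finset.mul_sum]
  refine Finset.sum_congr rfl fun s _ => Finset.sum_congr rfl fun h₁ _ =>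
    Finset.sum_congr rfl fun h₂ _ => Finset.sum_congr rfl fun a₁ _ =>
    Finset.sum_congr rfl fun a₂ _ => by ring

/-- Expected discounted reward of the first `t` stages. -/
def partialValue {t : ℕ} (θ₁ : RuleHist A₁ Z₁ t) (θ₂ : RuleHist A₂ Z₂ t) : ℝ :=
  ∑ w : Fin (t + 1) → S, ∑ h₁ : Hist A₁ Z₁ t, ∑ h₂ : Hist A₂ Z₂ t,
    G.trajProb θ₁ θ₂ w h₁ h₂ *
      ∑ k : Fin t, G.γ ^ (k : ℕ) * G.r (w k.castSucc) (h₁ k).1 (h₂ k).1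

theorem partialValue_zero (θ₁ : RuleHist A₁ Z₁ 0) (θ₂ : RuleHist A₂ Z₂ 0) :
    G.partialValue θ₁ θ₂ = 0 := by
  simp [partialValue]

theorem partialValue_succ {t : ℕ} (θ₁ : RuleHist A₁ Z₁ (t + 1)) (θ₂ : RuleHist A₂ Z₂ (t + 1)) :
    G.partialValue θ₁ θ₂ = G.partialValue θ₁.init θ₂.init +
      G.γ ^ t * G.ρ₂ (G.state₂ θ₁ θ₂.init) θ₂.last := by
  -- The earlier rewards ignore the last actions, so both rules of stage `t` also sum out to one.
  have h := G.sum_trajProb_succ θ₁ θ₂ fun w h₁ h₂ _ _ =>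
    ∑ k : Fin t, G.γ ^ (k : ℕ) * G.r (w k.castSucc) (h₁ k).1 (h₂ k).1
  simp_rw [← Finset.sum_mul, ← Finset.mul_sum, stdSimplex.sum_eq_one, mul_one,
    stdSimplex.sum_eq_one, one_mul] at h
  rw [ρ₂_state₂_eq]
  simp only [partialValue]
  rw [← h]
  simp_rw [Finset.mul_sum (a := G.γ ^ t), ← Finset.sum_add_distrib]
  refine Finset.sum_congr rfl fun w _ => Finset.sum_congr rfl fun h₁ _ =>
    Finset.sum_congr rfl fun h₂ _ => ?_
  rw [Fin.sum_univ_castSucc, mul_add]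
  congr 1
  simp only [Fin.val_last]
  ring

/-- The state forgets earlier hidden states, but their weight given the histories is free of the
rules, and the action probabilities on reachable histories can be recovered stage by stage as
products. This makes `termReturn` well defined. -/
theorem partialValue_congr {t : ℕ} {θ₁ θ₁' : RuleHist A₁ Z₁ t} {θ₂ θ₂' : RuleHist A₂ Z₂ t}
    (h : G.state₁ θ₁ θ₂ = G.state₁ θ₁' θ₂') : G.partialValue θ₁ θ₂ = G.partialValue θ₁' θ₂' := by
  induction t with
  | zero => simp [partialValue_zero]
  | succ t ih =>
    rw [partialValue_succ, partialValue_succ, ih (G.state₁_init_congr h), G.ρ₂_state₂_congr h]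

/-! ### Returns split into past and future -/

theorem ret₁_eq {t : ℕ} (ht : t < G.ℓ) (x : Occ₁ S A₁ A₂ Z₁ Z₂ t) (π₁ : G.Policy₁)
    (π₂ : G.Policy₂) : G.ret₁ t x π₁ π₂ = G.ρ₂ (τ₁ x (π₁ ⟨t, ht⟩)) (π₂ ⟨t, ht⟩) +
      G.γ * G.ret₁ (t + 1) (G.τ₂ (τ₁ x (π₁ ⟨t, ht⟩)) (π₂ ⟨t, ht⟩)) π₁ π₂ := by
  rw [ret₁, dif_pos ht, ρ₁, γ₁, γ₂, zero_add, one_mul]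

theorem ret₂_eq {t : ℕ} (ht : t < G.ℓ) (x : Occ₂ S A₁ A₂ Z₁ Z₂ t) (π₁ : G.Policy₁)
    (π₂ : G.Policy₂) : G.ret₂ t x π₁ π₂ = G.ρ₂ x (π₂ ⟨t, ht⟩) +
      G.γ * G.ret₁ (t + 1) (G.τ₂ x (π₂ ⟨t, ht⟩)) π₁ π₂ := by
  rw [ret₂, dif_pos ht, γ₂]

theorem ret₁_of_le {t : ℕ} (ht : G.ℓ ≤ t) (x : Occ₁ S A₁ A₂ Z₁ Z₂ t) (π₁ : G.Policy₁)
    (π₂ : G.Policy₂) : G.ret₁ t x π₁ π₂ = 0 := by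
  rw [ret₁, dif_neg ht.not_gt]

theorem ret₁_eq_ret₂ {t : ℕ} (ht : t < G.ℓ) (x : Occ₁ S A₁ A₂ Z₁ Z₂ t) (π₁ : G.Policy₁)
    (π₂ : G.Policy₂) : G.ret₁ t x π₁ π₂ = G.ret₂ t (τ₁ x (π₁ ⟨t, ht⟩)) π₁ π₂ := by
  rw [ret₁_eq G ht, ret₂_eq G ht]

theorem ret₁_zero_eq {t : ℕ} (ht : t ≤ G.ℓ) (π₁ : G.Policy₁) (π₂ : G.Policy₂) :
    G.ret₁ 0 G.x₀ π₁ π₂ = G.partialValue (π₁.take t ht) (π₂.take t ht) +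
      G.γ ^ t * G.ret₁ t (G.state₁ (π₁.take t ht) (π₂.take t ht)) π₁ π₂ := by
  induction t with
  | zero => simp [partialValue_zero, state₁]
  | succ t ih =>
    have ht' : t < G.ℓ := ht
    rw [ih ht'.le, partialValue_succ, ret₁_eq G ht', pow_succ, mul_add, ← add_assoc, mul_assoc]
    rfl

theorem value_eq_ret₁ (π₁ : G.Policy₁) (π₂ : G.Policy₂) :
    G.value π₁ π₂ = G.ret₁ 0 G.x₀ π₁ π₂ := by
  rw [ret₁_zero_eq G le_rfl, ret₁_of_le G le_rfl, mul_zero, add_zero]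
  rfl

theorem value_eq_add {t : ℕ} (ht : t ≤ G.ℓ) (π₁ : G.Policy₁) (π₂ : G.Policy₂) :
    G.value π₁ π₂ = G.partialValue (π₁.take t ht) (π₂.take t ht) +
      G.γ ^ t * G.ret₁ t (G.state₁ (π₁.take t ht) (π₂.take t ht)) π₁ π₂ := by
  rw [value_eq_ret₁, ret₁_zero_eq]

theorem ret₁_congr {t : ℕ} (x : Occ₁ S A₁ A₂ Z₁ Z₂ t) {π₁ π₁' : G.Policy₁} {π₂ π₂' : G.Policy₂}
    (h₁ : ∀ k : Fin G.ℓ, t ≤ k → π₁ k = π₁' k) (h₂ : ∀ k : Fin G.ℓ, t ≤ k → π₂ k = π₂' k) :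
    G.ret₁ t x π₁ π₂ = G.ret₁ t x π₁' π₂' := by
  by_cases ht : t < G.ℓ
  · rw [ret₁_eq G ht, ret₁_eq G ht, h₁ ⟨t, ht⟩ le_rfl, h₂ ⟨t, ht⟩ le_rfl,
      ret₁_congr _ (fun k hk => h₁ k (Nat.le_of_succ_le hk))
        (fun k hk => h₂ k (Nat.le_of_succ_le hk))]
  · rw [ret₁_of_le G (not_lt.1 ht), ret₁_of_le G (not_lt.1 ht)]
termination_by G.ℓ - t

theorem value_congr_of_state₁_eq {t : ℕ} (ht : t ≤ G.ℓ) {π₁ π₁' : G.Policy₁} {π₂ π₂' : G.Policy₂}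
    (h : G.state₁ (π₁.take t ht) (π₂.take t ht) = G.state₁ (π₁'.take t ht) (π₂'.take t ht))
    (h₁ : ∀ k : Fin G.ℓ, t ≤ k → π₁ k = π₁' k) (h₂ : ∀ k : Fin G.ℓ, t ≤ k → π₂ k = π₂' k) :
    G.value π₁ π₂ = G.value π₁' π₂' := by
  rw [value_eq_add G ht, value_eq_add G ht, G.partialValue_congr h, h, ret₁_congr G _ h₁ h₂]

theorem value_congr {π₁ π₁' : G.Policy₁} {π₂ π₂' : G.Policy₂}
    (h : G.state₁ π₁ π₂ = G.state₁ π₁' π₂') : G.value π₁ π₂ = G.value π₁' π₂' :=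
  G.value_congr_of_state₁_eq le_rfl h (fun k hk => absurd k.2 hk.not_gt)
    fun k hk => absurd k.2 hk.not_gt

end ZSPOSG

end

noncomputable section

/-! ### Mixing decision rules -/

section Mixing

variable {A Z : Type*} [Fintype A] {t : ℕ}

open Classical in
/-- The mixture of two decision rules with the weights `w`, `w'` of the histories. -/
def mixRule (w w' : Hist A Z t → ℝ) (d d' : DecRule A Z t) : DecRule A Z t := fun h =>
  if hw : 0 ≤ w h ∧ 0 ≤ w' h ∧ 0 < w h + w' h then
    ⟨fun a => (w h * d h a + w' h * d' h a) / (w h + w' h),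
      fun a => div_nonneg (add_nonneg (mul_nonneg hw.1 ((d h).2.1 a))
        (mul_nonneg hw.2.1 ((d' h).2.1 a))) hw.2.2.le, by
        rw [← Finset.sum_div, Finset.sum_add_distrib, ← Finset.mul_sum, ← Finset.mul_sum,
          stdSimplex.sum_eq_one, stdSimplex.sum_eq_one, mul_one, mul_one, div_self hw.2.2.ne']⟩
  -- For nonnegative weights this branch has total weight zero, so the choice is immaterial.
  else d h

theorem add_mul_mixRule {w w' : Hist A Z t → ℝ} (hw : 0 ≤ w) (hw' : 0 ≤ w') (d d' : DecRule A Z t)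
    (h : Hist A Z t) (a : A) :
    (w h + w' h) * mixRule w w' d d' h a = w h * d h a + w' h * d' h a := by
  by_cases hp : 0 < w h + w' h
  · rw [mixRule, dif_pos ⟨hw h, hw' h, hp⟩]
    exact mul_div_cancel₀ _ hp.ne'
  · have h1 : 0 ≤ w h := hw h
    have h2 : 0 ≤ w' h := hw' h
    have h3 : w h = 0 := by linarith
    have h4 : w' h = 0 := by linarith
    simp [h3, h4]

/-- The inductive step of Kuhn's theorem: mixing at each history in proportion to the weights makes
realisation weights add. -/
theorem extendWeight_mixRule {w w' : Hist A Z t → ℝ} (hw : 0 ≤ w) (hw' : 0 ≤ w')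
    (d d' : DecRule A Z t) :
    extendWeight (w + w') (mixRule w w' d d') = extendWeight w d + extendWeight w' d' :=
  funext fun _ => add_mul_mixRule hw hw' d d' _ _

theorem extendWeight_nonneg {w : Hist A Z t → ℝ} (hw : 0 ≤ w) (d : DecRule A Z t) :
    0 ≤ extendWeight w d :=
  fun _ => mul_nonneg (hw _) ((d _).2.1 _)

variable {ℓ : ℕ}

/-- Realisation weights when play starts at stage `s` with weight `c`. -/
def weightFrom (c : ℝ) (s : ℕ) (π : RuleHist A Z ℓ) : (k : ℕ) → Hist A Z k → ℝ
  | 0 => fun _ => c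
  -- The default covers lengths up to `s`, where play has not begun; beyond the horizon it is a
  -- dummy.
  | k + 1 => if h : s ≤ k ∧ k < ℓ then extendWeight (weightFrom c s π k) (π ⟨k, h.2⟩) else fun _ => c

theorem weightFrom_self (c : ℝ) (s : ℕ) (π : RuleHist A Z ℓ) : weightFrom c s π s = fun _ => c := by
  cases s with
  | zero => rfl
  | succ s => rw [weightFrom, dif_neg (by omega)]

theorem weightFrom_succ (c : ℝ) {s k : ℕ} (π : RuleHist A Z ℓ) (hs : s ≤ k) (hk : k < ℓ) :
    weightFrom c s π (k + 1) = extendWeight (weightFrom c s π k) (π ⟨k, hk⟩) := by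
  rw [weightFrom, dif_pos ⟨hs, hk⟩]

theorem weightFrom_nonneg {c : ℝ} (hc : 0 ≤ c) (s : ℕ) (π : RuleHist A Z ℓ) (k : ℕ) :
    0 ≤ weightFrom c s π k := by
  induction k with
  | zero => exact fun _ => hc
  | succ k ih =>
    rw [weightFrom]
    split_ifs
    · exact extendWeight_nonneg ih _
    · exact fun _ => hc

/-- The policy that has the realisation weights of the mixture of `π` and `π'`. -/
def mixPolicy (c c' : ℝ) (s : ℕ) (π π' : RuleHist A Z ℓ) : RuleHist A Z ℓ := fun k =>
  mixRule (weightFrom c s π k) (weightFrom c' s π' k) (π k) (π' k)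

end Mixing

namespace ZSPOSG

variable {S A₁ A₂ Z₁ Z₂ : Type*} [Fintype S] [Fintype A₁] [Fintype A₂] [Fintype Z₁] [Fintype Z₂]
variable (G : ZSPOSG S A₁ A₂ Z₁ Z₂)

/-! ### Linearity of the return in realisation weights -/

theorem ρ₂_τ₁_scale {t : ℕ} (w₁ : Hist A₁ Z₁ t → ℝ) (w₂ : Hist A₂ Z₂ t → ℝ)
    (x : Occ₁ S A₁ A₂ Z₁ Z₂ t) (d₁ : DecRule A₁ Z₁ t) (d₂ : DecRule A₂ Z₂ t) :
    G.ρ₂ (τ₁ (scale w₁ w₂ x) d₁) d₂ = ∑ s, ∑ h₁, ∑ h₂, ∑ a₁, ∑ a₂,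
      w₁ h₁ * d₁ h₁ a₁ * (w₂ h₂ * d₂ h₂ a₂) * (x s h₁ h₂ * G.r s a₁ a₂) := by
  simp only [ρ₂, τ₁, scale]
  refine Finset.sum_congr rfl fun s _ => Finset.sum_congr rfl fun h₁ _ =>
    Finset.sum_congr rfl fun h₂ _ => Finset.sum_congr rfl fun a₁ _ =>
    Finset.sum_congr rfl fun a₂ _ => by ring

/-- Rewards and transitions are linear in player 1's weights, and the mixed policy carries the sum
of the weights. The opponent's weights and `x` stay arbitrary so that the induction can advance them
by a stage. At `t = s` the weights are the constants `c`, `c'`, which gives the affine identity for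
an arbitrary starting state. -/
theorem ret₁_scale_mixPolicy_left {c c' : ℝ} (hc : 0 ≤ c) (hc' : 0 ≤ c') {s t : ℕ} (hs : s ≤ t)
    (w₂ : Hist A₂ Z₂ t → ℝ) (x : Occ₁ S A₁ A₂ Z₁ Z₂ t) (π₁ π₁' : G.Policy₁) (π₂ : G.Policy₂) :
    G.ret₁ t (scale (weightFrom c s π₁ t + weightFrom c' s π₁' t) w₂ x)
        (mixPolicy c c' s π₁ π₁') π₂ =
      G.ret₁ t (scale (weightFrom c s π₁ t) w₂ x) π₁ π₂ +
        G.ret₁ t (scale (weightFrom c' s π₁' t) w₂ x) π₁' π₂ := by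
  by_cases ht : t < G.ℓ
  · have hw := weightFrom_nonneg hc s π₁ t
    have hw' := weightFrom_nonneg hc' s π₁' t
    simp only [ret₁_eq G ht, τ₂_τ₁_scale, mixPolicy, extendWeight_mixRule hw hw']
    have ih := ret₁_scale_mixPolicy_left hc hc' (hs.trans t.le_succ : s ≤ t + 1)
      (extendWeight w₂ (π₂ ⟨t, ht⟩)) (G.envStep x) π₁ π₁' π₂
    rw [weightFrom_succ c π₁ hs ht, weightFrom_succ c' π₁' hs ht] at ih
    rw [ih]
    have hρ : G.ρ₂ (τ₁ (scale (weightFrom c s π₁ t + weightFrom c' s π₁' t) w₂ x)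
        (mixRule (weightFrom c s π₁ t) (weightFrom c' s π₁' t) (π₁ ⟨t, ht⟩) (π₁' ⟨t, ht⟩)))
          (π₂ ⟨t, ht⟩) =
        G.ρ₂ (τ₁ (scale (weightFrom c s π₁ t) w₂ x) (π₁ ⟨t, ht⟩)) (π₂ ⟨t, ht⟩) +
        G.ρ₂ (τ₁ (scale (weightFrom c' s π₁' t) w₂ x) (π₁' ⟨t, ht⟩)) (π₂ ⟨t, ht⟩) := by
      simp only [ρ₂_τ₁_scale, Pi.add_apply, add_mul_mixRule hw hw', add_mul,
        Finset.sum_add_distrib]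
    rw [hρ]
    ring
  · simp only [ret₁_of_le G (not_lt.1 ht), add_zero]
termination_by G.ℓ - t

theorem ret₁_scale_mixPolicy_right {c c' : ℝ} (hc : 0 ≤ c) (hc' : 0 ≤ c') {s t : ℕ} (hs : s ≤ t)
    (w₁ : Hist A₁ Z₁ t → ℝ) (x : Occ₁ S A₁ A₂ Z₁ Z₂ t) (π₁ : G.Policy₁) (π₂ π₂' : G.Policy₂) :
    G.ret₁ t (scale w₁ (weightFrom c s π₂ t + weightFrom c' s π₂' t) x)
        π₁ (mixPolicy c c' s π₂ π₂') =
      G.ret₁ t (scale w₁ (weightFrom c s π₂ t) x) π₁ π₂ +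
        G.ret₁ t (scale w₁ (weightFrom c' s π₂' t) x) π₁ π₂' := by
  by_cases ht : t < G.ℓ
  · have hw := weightFrom_nonneg hc s π₂ t
    have hw' := weightFrom_nonneg hc' s π₂' t
    simp only [ret₁_eq G ht, τ₂_τ₁_scale, mixPolicy, extendWeight_mixRule hw hw']
    have ih := ret₁_scale_mixPolicy_right hc hc' (hs.trans t.le_succ : s ≤ t + 1)
      (extendWeight w₁ (π₁ ⟨t, ht⟩)) (G.envStep x) π₁ π₂ π₂'
    rw [weightFrom_succ c π₂ hs ht, weightFrom_succ c' π₂' hs ht] at ih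
    rw [ih]
    have hρ : G.ρ₂ (τ₁ (scale w₁ (weightFrom c s π₂ t + weightFrom c' s π₂' t) x) (π₁ ⟨t, ht⟩))
        (mixRule (weightFrom c s π₂ t) (weightFrom c' s π₂' t) (π₂ ⟨t, ht⟩) (π₂' ⟨t, ht⟩)) =
        G.ρ₂ (τ₁ (scale w₁ (weightFrom c s π₂ t) x) (π₁ ⟨t, ht⟩)) (π₂ ⟨t, ht⟩) +
        G.ρ₂ (τ₁ (scale w₁ (weightFrom c' s π₂' t) x) (π₁ ⟨t, ht⟩)) (π₂' ⟨t, ht⟩) := by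
      simp only [ρ₂_τ₁_scale, Pi.add_apply, add_mul_mixRule hw hw', add_mul, mul_add,
        Finset.sum_add_distrib]
    rw [hρ]
    ring
  · simp only [ret₁_of_le G (not_lt.1 ht), add_zero]
termination_by G.ℓ - t

theorem ret₁_smul {t : ℕ} (c : ℝ) (x : Occ₁ S A₁ A₂ Z₁ Z₂ t) (π₁ : G.Policy₁) (π₂ : G.Policy₂) :
    G.ret₁ t (c • x) π₁ π₂ = c * G.ret₁ t x π₁ π₂ := by
  by_cases ht : t < G.ℓ
  · have hτ₁ : τ₁ (c • x) (π₁ ⟨t, ht⟩) = c • τ₁ x (π₁ ⟨t, ht⟩) := by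
      funext s h₁ h₂ a₁
      simp only [τ₁, Pi.smul_apply, smul_eq_mul, mul_assoc]
    have hτ₂ : ∀ y : Occ₂ S A₁ A₂ Z₁ Z₂ t,
        G.τ₂ (c • y) (π₂ ⟨t, ht⟩) = c • G.τ₂ y (π₂ ⟨t, ht⟩) := by
      intro y
      funext s h₁ h₂
      simp only [τ₂, Pi.smul_apply, smul_eq_mul, mul_assoc, Finset.mul_sum]
    have hρ₂ : ∀ y : Occ₂ S A₁ A₂ Z₁ Z₂ t,
        G.ρ₂ (c • y) (π₂ ⟨t, ht⟩) = c * G.ρ₂ y (π₂ ⟨t, ht⟩) := by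
      intro y
      simp only [ρ₂, Pi.smul_apply, smul_eq_mul, mul_assoc, Finset.mul_sum]
    rw [ret₁_eq G ht, ret₁_eq G ht, hτ₁, hτ₂, hρ₂, ret₁_smul]
    ring
  · simp only [ret₁_of_le G (not_lt.1 ht), mul_zero]
termination_by G.ℓ - t

theorem ret₁_mixPolicy_left {c c' : ℝ} (hc : 0 ≤ c) (hc' : 0 ≤ c') (hcc : c + c' = 1) {t : ℕ}
    (x : Occ₁ S A₁ A₂ Z₁ Z₂ t) (π₁ π₁' : G.Policy₁) (π₂ : G.Policy₂) :
    G.ret₁ t x (mixPolicy c c' t π₁ π₁') π₂ = c * G.ret₁ t x π₁ π₂ + c' * G.ret₁ t x π₁' π₂ := by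
  have h := G.ret₁_scale_mixPolicy_left hc hc' (le_refl t) (fun _ => 1) x π₁ π₁' π₂
  simp only [weightFrom_self] at h
  rw [← ret₁_smul, ← ret₁_smul]
  convert h using 2
  · funext s h₁ h₂; simp [scale, hcc]
  · congr 1; funext s h₁ h₂; simp [scale]
  · congr 1; funext s h₁ h₂; simp [scale]

theorem ret₁_mixPolicy_right {c c' : ℝ} (hc : 0 ≤ c) (hc' : 0 ≤ c') (hcc : c + c' = 1) {t : ℕ}
    (x : Occ₁ S A₁ A₂ Z₁ Z₂ t) (π₁ : G.Policy₁) (π₂ π₂' : G.Policy₂) :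
    G.ret₁ t x π₁ (mixPolicy c c' t π₂ π₂') = c * G.ret₁ t x π₁ π₂ + c' * G.ret₁ t x π₁ π₂' := by
  have h := G.ret₁_scale_mixPolicy_right hc hc' (le_refl t) (fun _ => 1) x π₁ π₂ π₂'
  simp only [weightFrom_self] at h
  rw [← ret₁_smul, ← ret₁_smul]
  convert h using 2
  · funext s h₁ h₂; simp [scale, hcc]
  · congr 1; funext s h₁ h₂; simp [scale]
  · congr 1; funext s h₁ h₂; simp [scale]

/-! ### Continuity of the returns -/

section Continuity

variable {T : Type*} [TopologicalSpace T] {t : ℕ}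

theorem continuous_rule_apply {A Z : Type*} [Fintype A] {d : T → DecRule A Z t} (hd : Continuous d)
    (h : Hist A Z t) (a : A) : Continuous fun q => d q h a :=
  (continuous_apply a).comp (continuous_subtype_val.comp ((continuous_apply h).comp hd))

theorem continuous_τ₁ {x : T → Occ₁ S A₁ A₂ Z₁ Z₂ t} {d₁ : T → DecRule A₁ Z₁ t} (hx : Continuous x)
    (hd : Continuous d₁) : Continuous fun q => τ₁ (x q) (d₁ q) :=
  continuous_pi fun s => continuous_pi fun h₁ => continuous_pi fun h₂ => continuous_pi fun a₁ =>
    Continuous.mul (by fun_prop) (continuous_rule_apply hd h₁ a₁)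

theorem continuous_τ₂ {x : T → Occ₂ S A₁ A₂ Z₁ Z₂ t} {d₂ : T → DecRule A₂ Z₂ t} (hx : Continuous x)
    (hd : Continuous d₂) : Continuous fun q => G.τ₂ (x q) (d₂ q) :=
  continuous_pi fun s => continuous_pi fun h₁ => continuous_pi fun h₂ =>
    continuous_finsetSum _ fun s _ => Continuous.mul
      (Continuous.mul (by fun_prop) (continuous_rule_apply hd _ _)) continuous_const

theorem continuous_ρ₂ {x : T → Occ₂ S A₁ A₂ Z₁ Z₂ t} {d₂ : T → DecRule A₂ Z₂ t} (hx : Continuous x)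
    (hd : Continuous d₂) : Continuous fun q => G.ρ₂ (x q) (d₂ q) :=
  continuous_finsetSum _ fun s _ => continuous_finsetSum _ fun h₁ _ =>
    continuous_finsetSum _ fun h₂ _ => continuous_finsetSum _ fun a₁ _ =>
    continuous_finsetSum _ fun a₂ _ => Continuous.mul
      (Continuous.mul (by fun_prop) (continuous_rule_apply hd _ _)) continuous_const

theorem continuous_ret₁ {t : ℕ} {x : T → Occ₁ S A₁ A₂ Z₁ Z₂ t} {π₁ : T → G.Policy₁}
    {π₂ : T → G.Policy₂} (hx : Continuous x) (h₁ : Continuous π₁) (h₂ : Continuous π₂) :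
    Continuous fun q => G.ret₁ t (x q) (π₁ q) (π₂ q) := by
  by_cases ht : t < G.ℓ
  · simp only [ret₁_eq G ht]
    have hy := continuous_τ₁ hx ((continuous_apply (⟨t, ht⟩ : Fin G.ℓ)).comp h₁)
    have hd := (continuous_apply (⟨t, ht⟩ : Fin G.ℓ)).comp h₂
    exact (G.continuous_ρ₂ hy hd).add
      (continuous_const.mul (continuous_ret₁ (G.continuous_τ₂ hy hd) h₁ h₂))
  · simp only [ret₁_of_le G (not_lt.1 ht)]
    exact continuous_const
termination_by G.ℓ - t

theorem continuous_ret₂ (ht : t < G.ℓ) {x : T → Occ₂ S A₁ A₂ Z₁ Z₂ t} {π₁ : T → G.Policy₁}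
    {π₂ : T → G.Policy₂} (hx : Continuous x) (h₁ : Continuous π₁) (h₂ : Continuous π₂) :
    Continuous fun q => G.ret₂ t (x q) (π₁ q) (π₂ q) := by
  simp only [ret₂_eq G ht]
  have hd := (continuous_apply (⟨t, ht⟩ : Fin G.ℓ)).comp h₂
  exact (G.continuous_ρ₂ hx hd).add
    (continuous_const.mul (G.continuous_ret₁ (G.continuous_τ₂ hx hd) h₁ h₂))

end Continuity

/-! ### The values of the continuation games -/

variable [Nonempty A₁] [Nonempty A₂]

theorem isMaxMin_ret₁ (t : ℕ) (x : Occ₁ S A₁ A₂ Z₁ Z₂ t) :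
    IsMaxMin (G.ret₁ t x) (G.vSeq₁ t x) :=
  isMaxMin_iSup_iInf (G.continuous_ret₁ continuous_const continuous_fst continuous_snd)

theorem isMaxMin_ret₂ {t : ℕ} (ht : t < G.ℓ) (x : Occ₂ S A₁ A₂ Z₁ Z₂ t) :
    IsMaxMin (G.ret₂ t x) (G.vSeq₂ t x) :=
  isMaxMin_iSup_iInf (G.continuous_ret₂ ht continuous_const continuous_fst continuous_snd)

theorem exists_saddle_point_ret₁ (t : ℕ) (x : Occ₁ S A₁ A₂ Z₁ Z₂ t) :
    ∃ π₁ π₂, (∀ π₁', G.ret₁ t x π₁' π₂ ≤ G.vSeq₁ t x) ∧ ∀ π₂', G.vSeq₁ t x ≤ G.ret₁ t x π₁ π₂' :=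
  exists_saddle_point (G.continuous_ret₁ continuous_const continuous_fst continuous_snd)
    (fun π₁ π₁' c c' hc hc' hcc => ⟨mixPolicy c c' t π₁ π₁', fun π₂ =>
      G.ret₁_mixPolicy_left hc hc' hcc x π₁ π₁' π₂⟩)
    fun π₂ π₂' c c' hc hc' hcc => ⟨mixPolicy c c' t π₂ π₂', fun π₁ =>
      G.ret₁_mixPolicy_right hc hc' hcc x π₁ π₂ π₂'⟩

/-- Reduces the game after player 1's commitment to the stage-boundary game with that rule frozen.
-/
theorem ret₂_τ₁_eq {t : ℕ} (ht : t < G.ℓ) (x : Occ₁ S A₁ A₂ Z₁ Z₂ t) (d₁ : DecRule A₁ Z₁ t)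
    (π₁ : G.Policy₁) (π₂ : G.Policy₂) :
    G.ret₂ t (τ₁ x d₁) π₁ π₂ = G.ret₁ t x (Function.update π₁ ⟨t, ht⟩ d₁) π₂ := by
  rw [ret₂_eq G ht, ret₁_eq G ht, Function.update_self]
  congr 2
  refine G.ret₁_congr _ (fun k hk => ?_) fun k _ => rfl
  rw [Function.update_of_ne]
  rintro rfl
  exact absurd hk (Nat.not_succ_le_self t)

theorem exists_saddle_point_ret₂ {t : ℕ} (ht : t < G.ℓ) {x : Occ₂ S A₁ A₂ Z₁ Z₂ t}
    (hx : x ∈ G.X₂ t) :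
    ∃ π₁ π₂, (∀ π₁', G.ret₂ t x π₁' π₂ ≤ G.vSeq₂ t x) ∧
      ∀ π₂', G.vSeq₂ t x ≤ G.ret₂ t x π₁ π₂' := by
  obtain ⟨θ₁, θ₂, rfl⟩ := hx
  rw [← state₂_eq_occ₂, state₂]
  refine exists_saddle_point (G.continuous_ret₂ ht continuous_const continuous_fst continuous_snd)
    -- Player 1's rule of stage `t` is already inside the state, so its mixing starts at `t + 1`,
    -- while player 2 still mixes from `t` on.
    (fun π₁ π₁' c c' hc hc' hcc => ⟨mixPolicy c c' (t + 1) π₁ π₁', fun π₂ => ?_⟩)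
    fun π₂ π₂' c c' hc hc' hcc => ⟨mixPolicy c c' t π₂ π₂', fun π₁ => ?_⟩
  · simp only [ret₂_eq G ht]
    rw [G.ret₁_mixPolicy_left hc hc' hcc]
    linear_combination -G.ρ₂ (τ₁ (G.state₁ θ₁.init θ₂) θ₁.last) (π₂ ⟨t, ht⟩) * hcc
  · simp only [G.ret₂_τ₁_eq ht]
    exact G.ret₁_mixPolicy_right hc hc' hcc _ _ π₂ π₂'

end ZSPOSG

end

noncomputable section

/-! ### Transport of values and extension of rule histories -/

theorem IsMaxMin.comp_surjective {α β α' β' : Type*} {f : α → β → ℝ} {v : ℝ} (h : IsMaxMin f v)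
    {e₁ : α' → α} {e₂ : β' → β} (h₁ : e₁.Surjective) (h₂ : e₂.Surjective) :
    IsMaxMin (fun a b => f (e₁ a) (e₂ b)) v := by
  obtain ⟨m, hm, hv⟩ := h
  refine ⟨m ∘ e₁, fun a => ?_, by rwa [h₁.range_comp]⟩
  have := h₂.range_comp (f (e₁ a))
  exact this.symm ▸ hm (e₁ a)

theorem IsMinMax.comp_surjective {α β α' β' : Type*} {f : α → β → ℝ} {v : ℝ} (h : IsMinMax f v)
    {e₁ : α' → α} {e₂ : β' → β} (h₁ : e₁.Surjective) (h₂ : e₂.Surjective) :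
    IsMinMax (fun a b => f (e₁ a) (e₂ b)) v := by
  obtain ⟨m, hm, hv⟩ := h
  refine ⟨m ∘ e₂, fun b => ?_, by rwa [h₂.range_comp]⟩
  have := h₁.range_comp fun a => f a (e₂ b)
  exact this.symm ▸ hm (e₂ b)

namespace RuleHist

variable {A Z : Type*} [Fintype A] {t ℓ : ℕ}

theorem exists_take_eq [Nonempty A] (ht : t ≤ ℓ) (θ : RuleHist A Z t) :
    ∃ π : RuleHist A Z ℓ, π.take t ht = θ := by
  refine ⟨fun k => if h : (k : ℕ) < t then θ ⟨k, h⟩ else fun _ => Classical.arbitrary _, ?_⟩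
  funext j
  exact dif_pos j.2

theorem take_snoc_apply (π : RuleHist A Z ℓ) (ht : t < ℓ) :
    (π.take t ht.le).snoc (π ⟨t, ht⟩) = π.take (t + 1) ht :=
  snoc_init_last (π.take (t + 1) ht)

end RuleHist

namespace ZSPOSG

variable {S A₁ A₂ Z₁ Z₂ : Type*} [Fintype S] [Fintype A₁] [Fintype A₂] [Fintype Z₁] [Fintype Z₂]
variable (G : ZSPOSG S A₁ A₂ Z₁ Z₂)

/-! ### Executing strategies -/

/-- A strategy that ignores its local states plays a prescribed policy; this yields surjectivity of
execution. -/
theorem playTo₁_const (π₁ : G.Policy₁) {t : ℕ} (ht : t ≤ G.ℓ) :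
    G.playTo₁ (fun k _ => π₁ k) t ht = π₁.take t ht := by
  induction t with
  | zero => exact funext fun k => k.elim0
  | succ t ih =>
    rw [playTo₁, ih (Nat.le_of_succ_le ht)]
    exact π₁.take_snoc_apply ht

theorem playTo₂_const (π₂ : G.Policy₂) {t : ℕ} (ht : t ≤ G.ℓ) :
    G.playTo₂ (fun k _ => π₂ k) t ht = π₂.take t ht := by
  induction t with
  | zero => exact funext fun k => k.elim0
  | succ t ih =>
    rw [playTo₂, ih (Nat.le_of_succ_le ht)]
    exact π₂.take_snoc_apply ht

theorem exec₁_const (π₁ : G.Policy₁) : G.exec₁ (fun k _ => π₁ k) = π₁ :=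
  G.playTo₁_const π₁ le_rfl

theorem exec₂_const (π₂ : G.Policy₂) : G.exec₂ (fun k _ => π₂ k) = π₂ :=
  G.playTo₂_const π₂ le_rfl

theorem exec₁_surjective : Function.Surjective G.exec₁ := fun π₁ => ⟨_, G.exec₁_const π₁⟩

theorem exec₂_surjective : Function.Surjective G.exec₂ := fun π₂ => ⟨_, G.exec₂_const π₂⟩

theorem exists_playTo₁_eq [Nonempty A₁] {t : ℕ} (ht : t ≤ G.ℓ) (θ₁ : RuleHist A₁ Z₁ t) :
    ∃ σ₁, G.playTo₁ σ₁ t ht = θ₁ := by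
  obtain ⟨π₁, rfl⟩ := θ₁.exists_take_eq ht
  exact ⟨_, G.playTo₁_const π₁ ht⟩

theorem exists_playTo₂_eq [Nonempty A₂] {t : ℕ} (ht : t ≤ G.ℓ) (θ₂ : RuleHist A₂ Z₂ t) :
    ∃ σ₂, G.playTo₂ σ₂ t ht = θ₂ := by
  obtain ⟨π₂, rfl⟩ := θ₂.exists_take_eq ht
  exact ⟨_, G.playTo₂_const π₂ ht⟩

theorem seqReturn_eq_value (σ₁ : G.Strategy₁) (σ₂ : G.Strategy₂) :
    G.seqReturn σ₁ σ₂ = G.value (G.exec₁ σ₁) (G.exec₂ σ₂) :=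
  (G.value_eq_ret₁ _ _).symm

/-! ### Value preservation -/

theorem termReturn_occ₁ (π₁ : G.Policy₁) (π₂ : G.Policy₂) :
    G.termReturn (G.occ₁ π₁ π₂) = G.value π₁ π₂ := by
  have : {v | ∃ (π₁' : G.Policy₁) (π₂' : G.Policy₂),
      G.state₁ π₁' π₂' = G.occ₁ π₁ π₂ ∧ v = G.ret₁ 0 G.x₀ π₁' π₂'} = {G.value π₁ π₂} := by
    ext v
    simp only [Set.mem_ofPred_eq, Set.mem_singleton_iff, ← state₁_eq_occ₁, ← value_eq_ret₁]
    constructor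
    · rintro ⟨π₁', π₂', h, rfl⟩
      exact G.value_congr h
    · rintro rfl
      exact ⟨π₁, π₂, rfl, rfl⟩
  rw [termReturn, this, csInf_singleton]

theorem ρLoc₁_fam₁ (π₁ : G.Policy₁) : G.ρLoc₁ (G.fam₁ π₁) = ⨅ π₂, G.value π₁ π₂ := by
  rw [ρLoc₁, iInf]
  congr 1
  ext v
  constructor
  · rintro ⟨_, ⟨π₂, rfl⟩, rfl⟩
    exact ⟨π₂, (G.termReturn_occ₁ π₁ π₂).symm⟩
  · rintro ⟨π₂, rfl⟩
    exact ⟨_, ⟨π₂, rfl⟩, G.termReturn_occ₁ π₁ π₂⟩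

theorem ρLoc₂_famEnd₂ (π₂ : G.Policy₂) : G.ρLoc₂ (G.famEnd₂ π₂) = ⨆ π₁, G.value π₁ π₂ := by
  rw [ρLoc₂, iSup]
  congr 1
  ext v
  constructor
  · rintro ⟨_, ⟨π₁, rfl⟩, rfl⟩
    exact ⟨π₁, (G.termReturn_occ₁ π₁ π₂).symm⟩
  · rintro ⟨π₁, rfl⟩
    exact ⟨_, ⟨π₁, rfl⟩, G.termReturn_occ₁ π₁ π₂⟩

theorem continuous_value {T : Type*} [TopologicalSpace T] {π₁ : T → G.Policy₁} {π₂ : T → G.Policy₂}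
    (h₁ : Continuous π₁) (h₂ : Continuous π₂) : Continuous fun q => G.value (π₁ q) (π₂ q) := by
  simp only [value_eq_ret₁]
  exact G.continuous_ret₁ continuous_const h₁ h₂

theorem isLeast_ρLoc₁ [Nonempty A₂] (π₁ : G.Policy₁) :
    IsLeast (Set.range fun π₂ => G.value π₁ π₂) (G.ρLoc₁ (G.fam₁ π₁)) := by
  have h : Continuous fun π₂ => G.value π₁ π₂ :=
    G.continuous_value continuous_const continuous_id
  rw [ρLoc₁_fam₁]
  exact isLeast_range_iInf h

theorem isGreatest_ρLoc₂ [Nonempty A₁] (π₂ : G.Policy₂) :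
    IsGreatest (Set.range fun π₁ => G.value π₁ π₂) (G.ρLoc₂ (G.famEnd₂ π₂)) := by
  have h : Continuous fun π₁ => G.value π₁ π₂ :=
    G.continuous_value continuous_id continuous_const
  rw [ρLoc₂_famEnd₂]
  exact isGreatest_range_iSup h

theorem value_eq_ret₁' : G.value = G.ret₁ 0 G.x₀ :=
  funext fun π₁ => funext fun π₂ => G.value_eq_ret₁ π₁ π₂

theorem valuePreservation [Nonempty A₁] [Nonempty A₂] : G.ValuePreservation := by
  have hmaxMin : IsMaxMin G.value (G.vSeq₁ 0 G.x₀) := by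
    rw [value_eq_ret₁']
    exact G.isMaxMin_ret₁ 0 G.x₀
  obtain ⟨π₁, π₂, h₂, h₁⟩ := G.exists_saddle_point_ret₁ 0 G.x₀
  rw [← value_eq_ret₁'] at h₁ h₂
  have hminMax := isMinMax_of_saddle_point
    (G.continuous_value continuous_fst continuous_snd) h₁ h₂
  have hseq : G.seqReturn = fun σ₁ σ₂ => G.value (G.exec₁ σ₁) (G.exec₂ σ₂) :=
    funext fun σ₁ => funext fun σ₂ => G.seqReturn_eq_value σ₁ σ₂
  have hleast := G.isLeast_ρLoc₁
  have hgreatest := G.isGreatest_ρLoc₂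
  exact
    { seqReturn_eq := G.seqReturn_eq_value
      value_eq := fun π₁ π₂ => by
        refine ⟨fun k _ => π₁ k, fun k _ => π₂ k, G.exec₁_const π₁, G.exec₂_const π₂, ?_⟩
        rw [seqReturn_eq_value, exec₁_const, exec₂_const]
      maxMin := hmaxMin
      minMax := hminMax
      maxMin_seq := hseq ▸ hmaxMin.comp_surjective G.exec₁_surjective G.exec₂_surjective
      minMax_seq := hseq ▸ hminMax.comp_surjective G.exec₁_surjective G.exec₂_surjective
      termReturn_eq := G.termReturn_occ₁
      local₁ := fun σ₁ => hleast _
      local₂ := fun σ₂ => hgreatest _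
      local_opt₁ := by
        constructor
        · refine ⟨fun k _ => π₁ k, ?_⟩
          simp only [exec₁_const]
          refine le_antisymm (((hleast π₁).2 ⟨π₂, rfl⟩).trans (h₂ π₁)) ?_
          obtain ⟨π₂', h⟩ := (hleast π₁).1
          exact (h₁ π₂').trans h.le
        · rintro _ ⟨σ₁, rfl⟩
          exact ((hleast _).2 ⟨π₂, rfl⟩).trans (h₂ _)
      local_opt₂ := by
        constructor
        · refine ⟨fun k _ => π₂ k, ?_⟩
          simp only [exec₂_const]
          refine le_antisymm ?_ ((h₁ π₂).trans ((hgreatest π₂).2 ⟨π₁, rfl⟩))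
          obtain ⟨π₁', h⟩ := (hgreatest π₂).1
          exact h.symm.le.trans (h₂ π₁')
        · rintro _ ⟨σ₂, rfl⟩
          exact (h₁ _).trans ((hgreatest _).2 ⟨π₁, rfl⟩) }

/-! ### Equilibria -/

/-- Returns depend on executed policies only, and execution is onto for each player separately, so
unilateral deviations in the two games have the same payoffs. -/
theorem equilibriumCorrespondence : G.EquilibriumCorrespondence := by
  have hsurj := G.exec₁_surjective.prodMap G.exec₂_surjective
  have hpre : equilibria G.seqReturn = Prod.map G.exec₁ G.exec₂ ⁻¹' equilibria G.value := by
    ext ⟨σ₁, σ₂⟩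
    simp only [equilibria, Set.mem_ofPred_eq, Set.mem_preimage, Prod.map_apply, seqReturn_eq_value,
      G.exec₁_surjective.forall, G.exec₂_surjective.forall]
  exact ⟨hsurj, hpre, by rw [hpre, Set.image_preimage_eq _ hsurj]⟩

/-! ### Information structure -/

/-- Equality of families only says that the state of `(θ₁, θ₂)` arises from `θ₁'` against some
`θ₂'`; the crossing lemma replaces `θ₂'` by `θ₂`. -/
theorem state₁_eq_of_fam₁_eq {t : ℕ} {θ₁ θ₁' : RuleHist A₁ Z₁ t} (h : G.fam₁ θ₁ = G.fam₁ θ₁')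
    (θ₂ : RuleHist A₂ Z₂ t) : G.state₁ θ₁ θ₂ = G.state₁ θ₁' θ₂ := by
  have hmem : G.occ₁ θ₁ θ₂ ∈ G.fam₁ θ₁' := h ▸ ⟨θ₂, rfl⟩
  obtain ⟨θ₂', h'⟩ := hmem
  simp only [← state₁_eq_occ₁] at h'
  rw [h', G.state₁_cross h'.symm]

theorem state₁_init_eq_of_fam₂_eq {t : ℕ} {θ₂ θ₂' : RuleHist A₂ Z₂ t}
    (h : G.fam₂ θ₂ = G.fam₂ θ₂') (θ₁ : RuleHist A₁ Z₁ (t + 1)) :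
    G.state₁ θ₁.init θ₂ = G.state₁ θ₁.init θ₂' := by
  have hmem : G.occ₂ θ₁ θ₂ ∈ G.fam₂ θ₂' := h ▸ ⟨θ₁, rfl⟩
  obtain ⟨θ₁', h'⟩ := hmem
  simp only [← state₂_eq_occ₂] at h'
  exact (G.state₁_cross (eq_of_τ₁_eq h')).symm

theorem informationEquivalence [Nonempty A₁] [Nonempty A₂] : G.InformationEquivalence where
  state₁_eq _ _ := G.state₁_eq_occ₁
  state₂_eq _ _ := G.state₂_eq_occ₂
  reward_eq _ _ := G.ρ₂_state₂_eq
  fam₁_snoc t _ θ₁ d₁ := by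
    ext y
    simp only [fam₁, τLoc₁, Set.mem_ofPred_eq, ← state₁_eq_occ₁]
    constructor
    · rintro ⟨θ₂, rfl⟩
      exact ⟨_, ⟨θ₂.init, rfl⟩, θ₂.last, by simp [state₁]⟩
    · rintro ⟨_, ⟨θ₂, rfl⟩, d₂, rfl⟩
      exact ⟨θ₂.snoc d₂, by simp [state₁]⟩
  fam₂_snoc t _ θ₂ d₂ := by
    ext y
    simp only [fam₂, τLoc₂, Set.mem_ofPred_eq, ← state₂_eq_occ₂]
    constructor
    · rintro ⟨θ₁, rfl⟩
      exact ⟨_, ⟨θ₁.init, rfl⟩, θ₁.last, by simp [state₂, state₁]⟩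
    · rintro ⟨_, ⟨θ₁, rfl⟩, d₁, rfl⟩
      exact ⟨θ₁.snoc d₁, by simp [state₂, state₁]⟩
  noInfo₁ σ₁ t ht := by
    ext y
    simp only [fam₁, Set.mem_ofPred_eq, Set.mem_range, ← state₁_eq_occ₁]
    constructor
    · rintro ⟨θ₂, rfl⟩
      obtain ⟨σ₂, rfl⟩ := G.exists_playTo₂_eq ht θ₂
      exact ⟨σ₂, rfl⟩
    · rintro ⟨σ₂, rfl⟩
      exact ⟨_, rfl⟩
  noInfo₂ σ₂ t ht := by
    ext y
    simp only [fam₂, Set.mem_ofPred_eq, Set.mem_range, ← state₂_eq_occ₂]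
    constructor
    · rintro ⟨θ₁, rfl⟩
      obtain ⟨σ₁, rfl⟩ := G.exists_playTo₁_eq ht θ₁
      exact ⟨σ₁, rfl⟩
    · rintro ⟨σ₁, rfl⟩
      exact ⟨_, rfl⟩
  noInfoEnd₂ σ₂ := by
    ext y
    simp only [famEnd₂, Set.mem_ofPred_eq, Set.mem_range, ← state₁_eq_occ₁]
    constructor
    · rintro ⟨π₁, rfl⟩
      exact ⟨fun k _ => π₁ k, by rw [exec₁_const]⟩
    · rintro ⟨σ₁, rfl⟩
      exact ⟨_, rfl⟩
  compatible₁ t _ θ₁ θ₂ d₁ := by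
    ext y
    simp only [φ₁, fam₁, fam₂, Set.mem_inter_iff, Set.mem_image, Set.mem_ofPred_eq,
      Set.mem_singleton_iff, ← state₁_eq_occ₁, ← state₂_eq_occ₂]
    constructor
    · rintro ⟨⟨_, ⟨θ₂', rfl⟩, rfl⟩, θ₁', h⟩
      simp only [state₂, RuleHist.init_snoc, RuleHist.last_snoc]
      -- A common element is reached from `θ₁` and from `θ₂`; once player 1's last action is summed
      -- out, crossing identifies it with the state of the pair.
      rw [G.state₁_cross (eq_of_τ₁_eq h)]
    · rintro rfl
      exact ⟨⟨_, ⟨θ₂, rfl⟩, by simp [state₂]⟩, _, rfl⟩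
  compatible₂ t _ θ₁ θ₂ d₂ := by
    ext y
    simp only [φ₂, fam₁, fam₂, Set.mem_inter_iff, Set.mem_image, Set.mem_ofPred_eq,
      Set.mem_singleton_iff, ← state₁_eq_occ₁, ← state₂_eq_occ₂]
    constructor
    · rintro ⟨⟨_, ⟨θ₁', rfl⟩, rfl⟩, θ₂', h⟩
      have h' : G.state₁ θ₁ θ₂' = G.state₁ θ₁' (θ₂.snoc d₂) := by
        rw [← h]
        simp [state₁, state₂]
      rw [G.state₁_cross h', h]
    · rintro rfl
      exact ⟨⟨_, ⟨θ₁, rfl⟩, by simp [state₁, state₂]⟩, _, rfl⟩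
  noCollapse₁ t _ θ₁ θ₁' h θ₂ := by
    rw [← state₁_eq_occ₁, ← state₁_eq_occ₁, G.state₁_eq_of_fam₁_eq h]
  noCollapse₂ t _ θ₂ θ₂' h θ₁ := by
    rw [← state₂_eq_occ₂, ← state₂_eq_occ₂, state₂, state₂, G.state₁_init_eq_of_fam₂_eq h]
  sameReturn₁ t ht π₁ π₁' h hπ π₂ :=
    G.value_congr_of_state₁_eq ht (G.state₁_eq_of_fam₁_eq h _) hπ fun _ _ => rfl
  sameReturn₂ t ht π₂ π₂' h hπ π₁ :=
    G.value_congr_of_state₁_eq ht.le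
      (G.state₁_init_eq_of_fam₂_eq h (RuleHist.take π₁ (t + 1) ht)) (fun _ _ => rfl) hπ

end ZSPOSG

end

noncomputable section

namespace ZSPOSG

variable {S A₁ A₂ Z₁ Z₂ : Type*} [Fintype S] [Fintype A₁] [Fintype A₂] [Fintype Z₁] [Fintype Z₂]
variable (G : ZSPOSG S A₁ A₂ Z₁ Z₂)

/-! ### The optimality equations -/

theorem τ₂_τ₁_eq_τSim {t : ℕ} (x : Occ₁ S A₁ A₂ Z₁ Z₂ t) (d₁ : DecRule A₁ Z₁ t)
    (d₂ : DecRule A₂ Z₂ t) : G.τ₂ (τ₁ x d₁) d₂ = G.τSim x d₁ d₂ := rfl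

theorem ρ₂_τ₁_eq_ρSim {t : ℕ} (x : Occ₁ S A₁ A₂ Z₁ Z₂ t) (d₁ : DecRule A₁ Z₁ t)
    (d₂ : DecRule A₂ Z₂ t) : G.ρ₂ (τ₁ x d₁) d₂ = G.ρSim x d₁ d₂ := rfl

theorem retSim_eq_ret₁ (t : ℕ) (x : Occ₁ S A₁ A₂ Z₁ Z₂ t) (π₁ : G.Policy₁) (π₂ : G.Policy₂) :
    G.retSim t x π₁ π₂ = G.ret₁ t x π₁ π₂ := by
  by_cases ht : t < G.ℓ
  · rw [ret₁_eq G ht, retSim, dif_pos ht, retSim_eq_ret₁ (t + 1)]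
    rfl
  · rw [ret₁_of_le G (not_lt.1 ht), retSim, dif_neg ht]
termination_by G.ℓ - t

theorem vSim_eq_vSeq₁ (t : ℕ) (x : Occ₁ S A₁ A₂ Z₁ Z₂ t) : G.vSim t x = G.vSeq₁ t x := by
  simp only [vSim, vSeq₁, retSim_eq_ret₁]

theorem τ₁_mem_X₂ {t : ℕ} {x : Occ₁ S A₁ A₂ Z₁ Z₂ t} (hx : x ∈ G.X₁ t) (d₁ : DecRule A₁ Z₁ t) :
    τ₁ x d₁ ∈ G.X₂ t := by
  obtain ⟨θ₁, θ₂, rfl⟩ := hx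
  exact ⟨θ₁.snoc d₁, θ₂, by simp [← state₁_eq_occ₁, ← state₂_eq_occ₂, state₂]⟩

theorem exists_eq_τ₁_of_mem_X₂ {t : ℕ} {y : Occ₂ S A₁ A₂ Z₁ Z₂ t} (hy : y ∈ G.X₂ t) :
    ∃ x ∈ G.X₁ t, ∃ d₁, y = τ₁ x d₁ := by
  obtain ⟨θ₁, θ₂, rfl⟩ := hy
  exact ⟨_, ⟨θ₁.init, θ₂, rfl⟩, θ₁.last, by rw [← state₂_eq_occ₂, ← state₁_eq_occ₁]; rfl⟩

/-- The second equation, read at `τ₁ x d₁`, is the attained inner minimum of the simultaneous one,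
as the composed primitives agree definitionally. -/
theorem SeqOptimality.simOptimality {u₁ : (t : ℕ) → Occ₁ S A₁ A₂ Z₁ Z₂ t → ℝ}
    {u₂ : (t : ℕ) → Occ₂ S A₁ A₂ Z₁ Z₂ t → ℝ} (h : G.SeqOptimality u₁ u₂) : G.SimOptimality u₁ where
  terminal := h.terminal
  stage t ht x hx := by
    refine ⟨fun d₁ => u₂ t (τ₁ x d₁), fun d₁ => h.second t ht _ (G.τ₁_mem_X₂ hx d₁), ?_⟩
    simpa only [ρ₁, γ₁, zero_add, one_mul] using h.first t ht x hx

theorem SimOptimality.exists_seqOptimality {u : (t : ℕ) → Occ₁ S A₁ A₂ Z₁ Z₂ t → ℝ}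
    (h : G.SimOptimality u) : ∃ u₂, G.SeqOptimality u u₂ := by
  -- The second equation forces this choice of `u₂`. The minimum is attained on `X₂` because each
  -- state there is `τ₁ x d₁`, where the simultaneous equation supplies the minimiser.
  refine ⟨fun t y => sInf (Set.range fun d₂ : DecRule A₂ Z₂ t =>
    G.ρ₂ y d₂ + G.γ₂ * u (t + 1) (G.τ₂ y d₂)), h.terminal, fun t ht x hx => ?_, fun t ht y hy => ?_⟩
  · obtain ⟨m, hm, hu⟩ := h.stage t ht x hx
    have : (fun d₁ : DecRule A₁ Z₁ t => ρ₁ x d₁ + γ₁ * sInf (Set.range fun d₂ : DecRule A₂ Z₂ t =>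
        G.ρ₂ (τ₁ x d₁) d₂ + G.γ₂ * u (t + 1) (G.τ₂ (τ₁ x d₁) d₂))) = m := by
      funext d₁
      rw [ρ₁, γ₁, zero_add, one_mul]
      exact (hm d₁).csInf_eq
    rwa [this]
  · obtain ⟨x, hx, d₁, rfl⟩ := G.exists_eq_τ₁_of_mem_X₂ hy
    obtain ⟨m, hm, -⟩ := h.stage t ht x hx
    have := (hm d₁).csInf_eq
    exact this.symm ▸ hm d₁

variable [Nonempty A₁] [Nonempty A₂]

/-- Player 1 maximises over the whole policy; choosing the rule of stage `t` first merely splits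
this maximum, so no minimax argument enters. -/
theorem vSeq_first {t : ℕ} (ht : t < G.ℓ) (x : Occ₁ S A₁ A₂ Z₁ Z₂ t) :
    IsGreatest (Set.range fun d₁ : DecRule A₁ Z₁ t => ρ₁ x d₁ + γ₁ * G.vSeq₂ t (τ₁ x d₁))
      (G.vSeq₁ t x) := by
  simp only [ρ₁, γ₁, zero_add, one_mul]
  obtain ⟨m, hm, ⟨π₁, hπ₁⟩, hmax⟩ := G.isMaxMin_ret₁ t x
  have hle : ∀ d₁ : DecRule A₁ Z₁ t, G.vSeq₂ t (τ₁ x d₁) ≤ G.vSeq₁ t x := by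
    intro d₁
    obtain ⟨m', hm', ⟨π₁', hπ₁'⟩, -⟩ := G.isMaxMin_ret₂ ht (τ₁ x d₁)
    obtain ⟨π₂, h⟩ := (hm (Function.update π₁' ⟨t, ht⟩ d₁)).1
    rw [← G.ret₂_τ₁_eq ht] at h
    calc _ = m' π₁' := hπ₁'.symm
      _ ≤ _ := (hm' π₁').2 ⟨π₂, rfl⟩
      _ = _ := h
      _ ≤ _ := hmax ⟨_, rfl⟩
  refine ⟨⟨π₁ ⟨t, ht⟩, le_antisymm (hle _) ?_⟩, ?_⟩
  · obtain ⟨m', hm', -, hmax'⟩ := G.isMaxMin_ret₂ ht (τ₁ x (π₁ ⟨t, ht⟩))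
    obtain ⟨π₂, h⟩ := (hm' π₁).1
    calc _ = m π₁ := hπ₁.symm
      _ ≤ _ := (hm π₁).2 ⟨π₂, rfl⟩
      _ = _ := G.ret₁_eq_ret₂ ht x π₁ π₂
      _ = _ := h
      _ ≤ _ := hmax' ⟨_, rfl⟩
  · rintro _ ⟨d₁, rfl⟩
    exact hle d₁

theorem ret₂_update {t : ℕ} (ht : t < G.ℓ) (x : Occ₂ S A₁ A₂ Z₁ Z₂ t) (π₁ : G.Policy₁)
    (π₂ : G.Policy₂) (d₂ : DecRule A₂ Z₂ t) :
    G.ret₂ t x π₁ (Function.update π₂ ⟨t, ht⟩ d₂) =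
      G.ρ₂ x d₂ + G.γ * G.ret₁ (t + 1) (G.τ₂ x d₂) π₁ π₂ := by
  rw [ret₂_eq G ht, Function.update_self]
  congr 2
  refine G.ret₁_congr _ (fun k _ => rfl) fun k hk => ?_
  rw [Function.update_of_ne]
  rintro rfl
  exact absurd hk (Nat.not_succ_le_self t)

/-- In the max–min, player 1 fixes its later rules before `d₂` is chosen; in the equation they may
react to `d₂`. A saddle point shows that this freedom is worthless: `π₁` secures the value against
each `d₂`, and `π₂` caps every reaction. -/
theorem vSeq_second {t : ℕ} (ht : t < G.ℓ) {x : Occ₂ S A₁ A₂ Z₁ Z₂ t} (hx : x ∈ G.X₂ t) :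
    IsLeast (Set.range fun d₂ : DecRule A₂ Z₂ t =>
      G.ρ₂ x d₂ + G.γ₂ * G.vSeq₁ (t + 1) (G.τ₂ x d₂)) (G.vSeq₂ t x) := by
  obtain ⟨π₁, π₂, h₂, h₁⟩ := G.exists_saddle_point_ret₂ ht hx
  have hle : ∀ d₂ : DecRule A₂ Z₂ t,
      G.vSeq₂ t x ≤ G.ρ₂ x d₂ + G.γ₂ * G.vSeq₁ (t + 1) (G.τ₂ x d₂) := by
    intro d₂
    obtain ⟨m, hm, -, hmax⟩ := G.isMaxMin_ret₁ (t + 1) (G.τ₂ x d₂)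
    obtain ⟨π₂', h⟩ := (hm π₁).1
    -- `π₂'` is a best reply to `π₁` after stage `t`; the deviation plays `d₂` now and `π₂'` later.
    have h3 := h₁ (Function.update π₂' ⟨t, ht⟩ d₂)
    rw [ret₂_update] at h3
    have h4 : G.ret₁ (t + 1) (G.τ₂ x d₂) π₁ π₂' ≤ G.vSeq₁ (t + 1) (G.τ₂ x d₂) :=
      h.le.trans (hmax ⟨π₁, rfl⟩)
    exact h3.trans (add_le_add_right (mul_le_mul_of_nonneg_left h4 G.γ_nonneg) _)
  refine ⟨⟨π₂ ⟨t, ht⟩, le_antisymm ?_ (hle _)⟩, ?_⟩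
  · obtain ⟨m, hm, ⟨π₁', hπ₁'⟩, -⟩ := G.isMaxMin_ret₁ (t + 1) (G.τ₂ x (π₂ ⟨t, ht⟩))
    have h3 := h₂ π₁'
    rw [ret₂_eq G ht] at h3
    have h4 : G.vSeq₁ (t + 1) (G.τ₂ x (π₂ ⟨t, ht⟩)) ≤
        G.ret₁ (t + 1) (G.τ₂ x (π₂ ⟨t, ht⟩)) π₁' π₂ := hπ₁' ▸ (hm π₁').2 ⟨π₂, rfl⟩
    exact (add_le_add_right (mul_le_mul_of_nonneg_left h4 G.γ_nonneg) _).trans h3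
  · rintro _ ⟨d₂, rfl⟩
    exact hle d₂

theorem seqOptimality_vSeq : G.SeqOptimality G.vSeq₁ G.vSeq₂ where
  terminal x _ := by simp only [vSeq₁, ret₁_of_le G le_rfl, ciInf_const, ciSup_const]
  first _ ht x _ := G.vSeq_first ht x
  second _ ht _ hx := G.vSeq_second ht hx

theorem recoversSimultaneous : G.RecoversSimultaneous where
  transition _ _ x _ := G.τ₂_τ₁_eq_τSim x
  reward _ _ x _ d₁ d₂ := by rw [ρ₁, γ₁, zero_add, one_mul, ρ₂_τ₁_eq_ρSim]
  attained₁ t _ x _ := G.isMaxMin_ret₁ t x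
  attained₂ _ ht x _ := G.isMaxMin_ret₂ ht x
  attainedSim t _ x _ := by
    have : G.retSim t x = G.ret₁ t x :=
      funext fun π₁ => funext fun π₂ => G.retSim_eq_ret₁ t x π₁ π₂
    rw [this, vSim_eq_vSeq₁]
    exact G.isMaxMin_ret₁ t x
  seq_optimal := G.seqOptimality_vSeq
  sim_optimal := G.seqOptimality_vSeq.simOptimality G
  value_eq t _ x _ := (G.vSim_eq_vSeq₁ t x).symm
  compose _ _ h := h.simOptimality G
  decompose _ h := h.exists_seqOptimality G

end ZSPOSG

end

theorem theorem5 {S A₁ A₂ Z₁ Z₂ : Type*}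
    [Fintype S] [Fintype A₁] [Fintype A₂] [Fintype Z₁] [Fintype Z₂] [Nonempty A₁] [Nonempty A₂]
    (G : ZSPOSG S A₁ A₂ Z₁ Z₂) :
    G.IsLossless ∧ G.RecoversSimultaneous :=
  ⟨⟨G.valuePreservation, G.equilibriumCorrespondence, G.informationEquivalence⟩,
    G.recoversSimultaneous⟩
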